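/- Let $c\in\mathbb{C}$ with $\operatorname{Re}(c)>0$. Let $H_c=-\frac{d^2}{dx^2}+cx^2$ be the complex harmonic oscillator in $L^2(\mathbb{R})$, that is, the m-sectorial operator associated (by the first representation theorem) with the closed form $$Q_c(f,g)=\int_{\mathbb{R}} f'(x)\overline{g'(x)}\,dx+c\int_{\mathbb{R}} x^2f(x)\overline{g(x)}\,dx$$ on the form domain $V=W^{1,2}(\mathbb{R})\cap\{f\in L^2(\mathbb{R}):\int x^2|f(x)|^2\,dx<\infty\}$: a function $f\in V$ lies in $\mathrm{Dom}(H_c)$, with $H_cf=h$, if and only if $h\in L^2(\mathbb{R})$ and $Q_c(f,v)=\langle h,v\rangle$ for all $v\in V$. Write $\mathrm{Num}(H_c)=\{\langle H_cf,f\rangle: f\in\mathrm{Dom}(H_c),\ \|f\|=1\}$ for its numerical range. Then $$\mathrm{Num}(H_c)=\{t_1+ct_2\in\mathbb{C}: t_1,t_2\in\mathbb{R},\ t_1,t_2\ge 0,\ t_1t_2\ge \tfrac14\}.$$ If moreover $\operatorname{Im}(c)\ne 0$, then the spectrum of $H_c$ satisfies $\mathrm{Spec}(H_c)\subset\mathrm{Int}(\mathrm{Num}(H_c))$.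 -/

import Mathlib

open MeasureTheory ComplexConjugate
open scoped ContDiff

noncomputable section

/-! ### Numerical range and spectrum of an unbounded operator -/

/-- The numerical range `{(T x, x) : x ∈ Dom T, ‖x‖ = 1}` of an operator in a Hilbert space. Mathlib's
inner product is conjugate-linear in the first slot, so `(T x, x)` is `inner ℂ x (T x)`. -/
def numRange {E : Type*} [NormedAddCommGroup E] [InnerProductSpace ℂ E] (T : E →ₗ.[ℂ] E) :
    Set ℂ :=
  {z | ∃ x : T.domain, ‖(x : E)‖ = 1 ∧ z = inner ℂ (x : E) (T x)}

/-- The resolvent set: those `z` for which `T - z`, from `Dom T` to `E`, has an everywhere defined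
bounded two-sided inverse `R`. -/
def resolventPoints {E : Type*} [NormedAddCommGroup E] [NormedSpace ℂ E] (T : E →ₗ.[ℂ] E) :
    Set ℂ :=
  {z | ∃ R : E →L[ℂ] E,
    (∀ y : E, ∃ h : R y ∈ T.domain, T ⟨R y, h⟩ - z • R y = y) ∧
    (∀ x : T.domain, R (T x - z • (x : E)) = x)}

/-- The spectrum of an unbounded operator: the complement of the resolvent set. -/
def spec {E : Type*} [NormedAddCommGroup E] [NormedSpace ℂ E] (T : E →ₗ.[ℂ] E) : Set ℂ :=
  (resolventPoints T)ᶜ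

/-! ### Weak derivatives and the form domain -/

/-- The complex Hilbert space `L²(ℝ)`. -/
abbrev L2R : Type := Lp ℂ 2 (volume : Measure ℝ)

theorem L2R.integrable_mul {u : ℝ → ℂ} (f : L2R) (hu : MemLp u 2 volume) :
    Integrable fun x => f x * u x :=
  (Lp.memLp f).integrable_mul hu

theorem memLp_testFunction {φ : ℝ → ℂ} (hφ : ContDiff ℝ ∞ φ) (hs : HasCompactSupport φ) :
    MemLp φ 2 volume :=
  hφ.continuous.memLp_of_hasCompactSupport hs

theorem memLp_deriv_testFunction {φ : ℝ → ℂ} (hφ : ContDiff ℝ ∞ φ) (hs : HasCompactSupport φ) :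
    MemLp (deriv φ) 2 volume :=
  (hφ.continuous_deriv (by simp)).memLp_of_hasCompactSupport hs.deriv

/-- The pairs `(f, f')` in `L² × L²` such that `f'` is the weak derivative of `f`, that is,
`∫ f φ' = - ∫ f' φ` for all `φ ∈ C_c^∞(ℝ)`. -/
def weakDerivGraph : Submodule ℂ (L2R × L2R) where
  carrier := {p | ∀ φ : ℝ → ℂ, ContDiff ℝ ∞ φ → HasCompactSupport φ →
    ∫ x, p.1 x * deriv φ x = - ∫ x, p.2 x * φ x}
  zero_mem' := by
    intro φ _ _
    have h : ((0 : L2R) : ℝ → ℂ) =ᵐ[volume] 0 := Lp.coeFn_zero ℂ 2 volume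
    have h1 : ∫ x, (0 : L2R) x * deriv φ x = 0 :=
      integral_eq_zero_of_ae (by filter_upwards [h] with x hx; simp)
    have h2 : ∫ x, (0 : L2R) x * φ x = 0 :=
      integral_eq_zero_of_ae (by filter_upwards [h] with x hx; simp)
    simp only [Prod.fst_zero, Prod.snd_zero, h1, h2, neg_zero]
  add_mem' := by
    intro p q hp hq φ hφ hs
    have h1 : ∫ x, (p.1 + q.1 : L2R) x * deriv φ x
        = (∫ x, p.1 x * deriv φ x) + ∫ x, q.1 x * deriv φ x := by
      rw [← integral_add (p.1.integrable_mul (memLp_deriv_testFunction hφ hs))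
        (q.1.integrable_mul (memLp_deriv_testFunction hφ hs))]
      refine integral_congr_ae ?_
      filter_upwards [Lp.coeFn_add p.1 q.1] with x hx
      simp only [hx, Pi.add_apply]
      ring
    have h2 : ∫ x, (p.2 + q.2 : L2R) x * φ x
        = (∫ x, p.2 x * φ x) + ∫ x, q.2 x * φ x := by
      rw [← integral_add (p.2.integrable_mul (memLp_testFunction hφ hs))
        (q.2.integrable_mul (memLp_testFunction hφ hs))]
      refine integral_congr_ae ?_
      filter_upwards [Lp.coeFn_add p.2 q.2] with x hx
      simp only [hx, Pi.add_apply]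
      ring
    simp only [Prod.fst_add, Prod.snd_add, h1, h2, hp φ hφ hs, hq φ hφ hs]
    ring
  smul_mem' := by
    intro a p hp φ hφ hs
    have h1 : ∫ x, (a • p.1 : L2R) x * deriv φ x = a * ∫ x, p.1 x * deriv φ x := by
      rw [← integral_const_mul]
      refine integral_congr_ae ?_
      filter_upwards [Lp.coeFn_smul a p.1] with x hx
      simp [hx, mul_assoc]
    have h2 : ∫ x, (a • p.2 : L2R) x * φ x = a * ∫ x, p.2 x * φ x := by
      rw [← integral_const_mul]
      refine integral_congr_ae ?_
      filter_upwards [Lp.coeFn_smul a p.2] with x hx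
      simp [hx, mul_assoc]
    simp only [Prod.smul_fst, Prod.smul_snd, h1, h2, hp φ hφ hs]
    ring

theorem L2R.eq_zero_of_testFunctions (g : L2R)
    (h : ∀ φ : ℝ → ℂ, ContDiff ℝ ∞ φ → HasCompactSupport φ → ∫ x, g x * φ x = 0) : g = 0 := by
  rw [Lp.eq_zero_iff_ae_eq_zero]
  refine ae_eq_zero_of_integral_contDiff_smul_eq_zero
    ((Lp.memLp g).locallyIntegrable (by norm_num)) ?_
  intro u hu hs
  have := h (fun x => (u x : ℂ)) (Complex.ofRealCLM.contDiff.comp hu)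
    (hs.comp_left Complex.ofReal_zero)
  rw [← this]
  refine integral_congr_ae (Filter.Eventually.of_forall fun x => ?_)
  simp [mul_comm]

/-- The weak derivative is unique. -/
theorem weakDerivGraph_functional (p : L2R × L2R) (hp : p ∈ weakDerivGraph) (h : p.1 = 0) :
    p.2 = 0 := by
  refine p.2.eq_zero_of_testFunctions fun φ hφ hs => ?_
  have h1 := hp φ hφ hs
  have h2 : ∫ x, p.1 x * deriv φ x = 0 := by
    refine integral_eq_zero_of_ae ?_
    rw [h]
    filter_upwards [Lp.coeFn_zero ℂ 2 (volume : Measure ℝ)] with x hx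
    simp
  rw [h2] at h1
  exact neg_eq_zero.mp h1.symm

/-- The weak derivative as an operator in `L²(ℝ)`; its domain is the Sobolev space `W^{1,2}(ℝ)`. -/
def weakDeriv : L2R →ₗ.[ℂ] L2R := weakDerivGraph.toLinearPMap

theorem mem_graph_weakDeriv (p : L2R × L2R) : p ∈ weakDeriv.graph ↔ p ∈ weakDerivGraph := by
  rw [weakDeriv, Submodule.toLinearPMap_graph_eq _ weakDerivGraph_functional]

theorem memLp_position_iff (f : L2R) :
    MemLp (fun x : ℝ => (x : ℂ) * f x) 2 volume ↔ Integrable fun x : ℝ => x ^ 2 * ‖f x‖ ^ 2 := by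
  have hm : AEStronglyMeasurable (fun x : ℝ => (x : ℂ) * f x) volume :=
    Complex.continuous_ofReal.aestronglyMeasurable.mul (Lp.aestronglyMeasurable f)
  rw [memLp_two_iff_integrable_sq_norm hm]
  simp [mul_pow]

/-- The form domain `W^{1,2}(ℝ) ∩ {f ∈ L²(ℝ) : ∫ x² |f(x)|² dx < ∞}`. -/
def formDomain : Submodule ℂ L2R where
  carrier := {f | f ∈ weakDeriv.domain ∧ Integrable fun x : ℝ => x ^ 2 * ‖f x‖ ^ 2}
  zero_mem' := by
    refine ⟨zero_mem _, (memLp_position_iff 0).1 ?_⟩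
    refine (memLp_congr_ae ?_).2 (MemLp.zero' (ε := ℂ))
    filter_upwards [Lp.coeFn_zero ℂ 2 (volume : Measure ℝ)] with x hx
    simp
  add_mem' := by
    intro f g hf hg
    refine ⟨add_mem hf.1 hg.1, (memLp_position_iff _).1 ?_⟩
    refine (memLp_congr_ae ?_).2
      (((memLp_position_iff f).2 hf.2).add ((memLp_position_iff g).2 hg.2))
    filter_upwards [Lp.coeFn_add f g] with x hx
    simp only [hx, Pi.add_apply]
    ring
  smul_mem' := by
    intro a f hf
    refine ⟨Submodule.smul_mem _ a hf.1, (memLp_position_iff _).1 ?_⟩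
    refine (memLp_congr_ae ?_).2 (((memLp_position_iff f).2 hf.2).const_smul a)
    filter_upwards [Lp.coeFn_smul a f] with x hx
    simp [hx, mul_left_comm]

/-- The derivative `f'` of an element of the form domain. -/
def formDeriv (f : formDomain) : L2R := weakDeriv ⟨f, f.2.1⟩

/-- The sesquilinear form `Q_c(f,g) = ∫ f' conj(g') dx + c ∫ x² f conj(g) dx`. -/
def oscForm (c : ℂ) (f g : formDomain) : ℂ :=
  (∫ x : ℝ, formDeriv f x * conj (formDeriv g x)) +
    c * ∫ x : ℝ, (x : ℂ) ^ 2 * (f : L2R) x * conj ((g : L2R) x)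

theorem formDeriv_add (f g : formDomain) : formDeriv (f + g) = formDeriv f + formDeriv g :=
  weakDeriv.map_add ⟨f, f.2.1⟩ ⟨g, g.2.1⟩

theorem formDeriv_smul (a : ℂ) (f : formDomain) : formDeriv (a • f) = a • formDeriv f :=
  weakDeriv.map_smul a ⟨f, f.2.1⟩

theorem integral_mul_conj_eq_inner (f g : L2R) : ∫ x : ℝ, f x * conj (g x) = inner ℂ g f := by
  simp [L2.inner_def, RCLike.inner_apply]

theorem integrable_position_form (f g : formDomain) :
    Integrable fun x : ℝ => (x : ℂ) ^ 2 * (f : L2R) x * conj ((g : L2R) x) := by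
  have := ((memLp_position_iff f).2 f.2.2).integrable_mul ((memLp_position_iff g).2 g.2.2).star
  refine this.congr (Filter.Eventually.of_forall fun x => ?_)
  simp
  ring

theorem oscForm_add_left (c : ℂ) (f g v : formDomain) :
    oscForm c (f + g) v = oscForm c f v + oscForm c g v := by
  have h : ∫ x : ℝ, (x : ℂ) ^ 2 * ((f + g : formDomain) : L2R) x * conj ((v : L2R) x)
      = (∫ x : ℝ, (x : ℂ) ^ 2 * (f : L2R) x * conj ((v : L2R) x))
        + ∫ x : ℝ, (x : ℂ) ^ 2 * (g : L2R) x * conj ((v : L2R) x) := by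
    rw [← integral_add (integrable_position_form f v) (integrable_position_form g v)]
    refine integral_congr_ae ?_
    filter_upwards [Lp.coeFn_add (f : L2R) (g : L2R)] with x hx
    simp only [Submodule.coe_add, hx, Pi.add_apply]
    ring
  rw [oscForm, oscForm, oscForm, h]
  simp only [integral_mul_conj_eq_inner, formDeriv_add, inner_add_right]
  ring

theorem oscForm_smul_left (c a : ℂ) (f v : formDomain) :
    oscForm c (a • f) v = a * oscForm c f v := by
  have h : ∫ x : ℝ, (x : ℂ) ^ 2 * ((a • f : formDomain) : L2R) x * conj ((v : L2R) x)
      = a * ∫ x : ℝ, (x : ℂ) ^ 2 * (f : L2R) x * conj ((v : L2R) x) := by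
    rw [← integral_const_mul]
    refine integral_congr_ae ?_
    filter_upwards [Lp.coeFn_smul a (f : L2R)] with x hx
    simp only [Submodule.coe_smul, hx, Pi.smul_apply, smul_eq_mul]
    ring
  rw [oscForm, oscForm, h]
  simp only [integral_mul_conj_eq_inner, formDeriv_smul, inner_smul_right]
  ring

/-! ### The operator associated with the form -/

/-- The graph of the operator associated with `Q_c`: the pairs `(f, h)` with `f` in the form domain
and `Q_c(f, v) = (h, v)` for every `v` in the form domain. -/
def oscGraph (c : ℂ) : Submodule ℂ (L2R × L2R) where
  carrier := {p | ∃ f : formDomain, (f : L2R) = p.1 ∧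
    ∀ v : formDomain, oscForm c f v = inner ℂ (v : L2R) p.2}
  zero_mem' := by
    refine ⟨0, rfl, fun v => ?_⟩
    have := oscForm_smul_left c 0 0 v
    simpa using this
  add_mem' := by
    rintro p q ⟨f, hf, hf'⟩ ⟨g, hg, hg'⟩
    refine ⟨f + g, by simp [hf, hg], fun v => ?_⟩
    rw [oscForm_add_left, hf', hg', Prod.snd_add, inner_add_right]
  smul_mem' := by
    rintro a p ⟨f, hf, hf'⟩
    refine ⟨a • f, by simp [hf], fun v => ?_⟩
    rw [oscForm_smul_left, hf', Prod.smul_snd, inner_smul_right]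

/-- Test functions belong to the form domain. -/
theorem testFunction_mem_formDomain {φ : ℝ → ℂ} (hφ : ContDiff ℝ ∞ φ)
    (hs : HasCompactSupport φ) : (memLp_testFunction hφ hs).toLp φ ∈ formDomain := by
  have hc := (memLp_testFunction hφ hs).coeFn_toLp
  have hd := (memLp_deriv_testFunction hφ hs).coeFn_toLp
  refine ⟨?_, (memLp_position_iff _).1 ?_⟩
  · have hg : ((memLp_testFunction hφ hs).toLp φ, (memLp_deriv_testFunction hφ hs).toLp (deriv φ))
        ∈ weakDeriv.graph := by
      rw [mem_graph_weakDeriv]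
      intro ψ hψ hψs
      have e1 : ∫ x, (memLp_testFunction hφ hs).toLp φ x * deriv ψ x = ∫ x, φ x * deriv ψ x :=
        integral_congr_ae (by filter_upwards [hc] with x hx; rw [hx])
      have e2 : ∫ x, (memLp_deriv_testFunction hφ hs).toLp (deriv φ) x * ψ x
          = ∫ x, deriv φ x * ψ x :=
        integral_congr_ae (by filter_upwards [hd] with x hx; rw [hx])
      simp only [e1, e2]
      have hm := memLp_testFunction hφ hs
      have hm' := memLp_deriv_testFunction hφ hs
      have km := memLp_testFunction hψ hψs
      have km' := memLp_deriv_testFunction hψ hψs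
      exact integral_mul_deriv_eq_deriv_mul_of_integrable
        (fun x _ => (hφ.differentiable (by simp) x).hasDerivAt)
        (fun x _ => (hψ.differentiable (by simp) x).hasDerivAt)
        (hm.integrable_mul km') (hm'.integrable_mul km) (hm.integrable_mul km)
    exact LinearPMap.mem_domain_of_mem_graph hg
  · have hm : MemLp (fun x : ℝ => (x : ℂ) * φ x) 2 volume :=
      (Complex.continuous_ofReal.mul hφ.continuous).memLp_of_hasCompactSupport hs.mul_left
    refine (memLp_congr_ae ?_).2 hm
    filter_upwards [hc] with x hx
    rw [hx]

/-- The operator associated with `Q_c` is single-valued, since the form domain is dense. -/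
theorem oscGraph_functional (c : ℂ) (p : L2R × L2R) (hp : p ∈ oscGraph c) (h : p.1 = 0) :
    p.2 = 0 := by
  obtain ⟨f, hf, hf'⟩ := hp
  have hf0 : f = 0 := Subtype.ext (hf.trans h)
  refine p.2.eq_zero_of_testFunctions fun φ hφ hs => ?_
  have hφ' : ContDiff ℝ ∞ fun x => conj (φ x) := Complex.conjCLE.contDiff.comp hφ
  have hs' : HasCompactSupport fun x => conj (φ x) := hs.comp_left (map_zero _)
  have h1 := hf' ⟨_, testFunction_mem_formDomain hφ' hs'⟩
  have h0 := oscForm_smul_left c 0 0 ⟨_, testFunction_mem_formDomain hφ' hs'⟩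
  rw [zero_smul, zero_mul] at h0
  rw [hf0, h0, ← integral_mul_conj_eq_inner] at h1
  rw [h1]
  refine integral_congr_ae ?_
  filter_upwards [(memLp_testFunction hφ' hs').coeFn_toLp] with x hx
  simp only [hx, Complex.conj_conj]

/-- The complex harmonic oscillator `H_c = -d²/dx² + c x²` in `L²(ℝ)`: the operator associated with
the form `Q_c` by the first representation theorem. -/
def complexOscillator (c : ℂ) : L2R →ₗ.[ℂ] L2R := (oscGraph c).toLinearPMap

theorem mem_graph_complexOscillator (c : ℂ) (p : L2R × L2R) :
    p ∈ (complexOscillator c).graph ↔ ∃ f : formDomain, (f : L2R) = p.1 ∧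
      ∀ v : formDomain, oscForm c f v = inner ℂ (v : L2R) p.2 := by
  rw [complexOscillator, Submodule.toLinearPMap_graph_eq _ (oscGraph_functional c)]
  rfl

end

/-! For a unit vector `f` in the domain, `⟨H_c f, f⟩ = ‖f'‖² + c‖x f‖²`, so Heisenberg's inequality
gives one inclusion with `t₁ = ‖f'‖²`, `t₂ = ‖x f‖²`. Conversely, the Gaussian `e^{-αx²/2}` lies in
the domain whenever `Re α > 0`, and the two parameters of `α` realise every admissible `(t₁, t₂)`.

For the spectrum, write `z = s + c t` with `s, t` real. If `z` is not in the interior, some `a > 0`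
satisfies `s + a² t ≤ a`: the point lies weakly beyond a tangent line of the hyperbola `st = 1/4`.
Since `Im c ≠ 0`, there is `ρ` with `Re ρ = 1` and `Re (ρc) = a²`, and then `Re ρ(Q_c(f,f) - z‖f‖²)
≥ ‖(a x + d/dx) f‖²`. The right side vanishes only on multiples of `e^{-ax²/2}`, which is not an
eigenfunction for non-real `c`; so `H_c - z` is injective. By the spectral gap of the real
oscillator, a rank one term along this Gaussian makes the form coercive, hence invertible
(Lax–Milgram), and an injective rank one perturbation of an invertible operator is invertible
(`bijective_of_add_rankOne`).

Both halves rest on the commutation relation `inner_position_deriv` on the whole form domain. It is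
extended from test functions by density in the form norm, which follows from solving first order
equations whose solutions are Gaussians. -/

noncomputable section

/-! ### The du Bois-Reymond lemma -/

/-- A test function of mean zero is the derivative of a test function. -/
theorem exists_testFunction_deriv_eq {θ : ℝ → ℂ} (hθ : ContDiff ℝ ∞ θ) (hs : HasCompactSupport θ)
    (h0 : ∫ x, θ x = 0) :
    ∃ ψ : ℝ → ℂ, ContDiff ℝ ∞ ψ ∧ HasCompactSupport ψ ∧ deriv ψ = θ := by
  obtain ⟨R, hR⟩ := hs.isCompact.isBounded.subset_closedBall 0
  have hz : ∀ x, R < |x| → θ x = 0 := fun x hx => by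
    by_contra hne
    have := hR (subset_tsupport θ hne)
    rw [Metric.mem_closedBall, dist_zero_right, Real.norm_eq_abs] at this
    linarith
  have hd : ∀ x, HasDerivAt (fun x => ∫ t in (-(R + 1))..x, θ t) (θ x) x := fun x =>
    intervalIntegral.integral_hasDerivAt_right (hθ.continuous.intervalIntegrable _ _)
      (hθ.continuous.stronglyMeasurableAtFilter _ _) hθ.continuous.continuousAt
  have hdd : deriv (fun x => ∫ t in (-(R + 1))..x, θ t) = θ := funext fun x => (hd x).deriv
  refine ⟨fun x => ∫ t in (-(R + 1))..x, θ t, ?_, ?_, hdd⟩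
  · rw [contDiff_infty_iff_deriv, hdd]
    exact ⟨fun x => (hd x).differentiableAt, hθ⟩
  · refine HasCompactSupport.intro (isCompact_Icc (a := -(R + 1)) (b := R + 1)) fun x hx => ?_
    rw [Set.mem_Icc, not_and_or, not_le, not_le] at hx
    rcases hx with hx | hx
    · refine intervalIntegral.integral_zero_ae (Filter.Eventually.of_forall fun t ht => ?_)
      rw [Set.uIoc_of_ge hx.le] at ht
      -- `R` may be negative when the support is empty; then `θ` vanishes identically.
      by_cases hR0 : 0 ≤ R
      · exact hz t (lt_of_lt_of_le (by linarith [ht.2]) (neg_le_abs t))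
      · exact hz t (lt_of_lt_of_le (not_le.1 hR0) (abs_nonneg t))
    · rw [intervalIntegral.integral_eq_integral_of_support_subset, h0]
      intro t ht
      have : |t| ≤ R := not_lt.1 fun h => ht (hz t h)
      rw [abs_le] at this
      exact ⟨by linarith, by linarith⟩

/-- A locally integrable function with vanishing weak derivative is constant. -/
theorem ae_eq_const_of_integral_mul_deriv_eq_zero {u : ℝ → ℂ} (hu : LocallyIntegrable u)
    (h : ∀ ψ : ℝ → ℂ, ContDiff ℝ ∞ ψ → HasCompactSupport ψ → ∫ x, u x * deriv ψ x = 0) :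
    ∃ C : ℂ, ∀ᵐ x, u x = C := by
  let b : ContDiffBump (0 : ℝ) := ⟨1, 2, by norm_num, by norm_num⟩
  let η : ℝ → ℂ := fun x => (b.normed volume x : ℂ)
  have hη : ContDiff ℝ ∞ η := Complex.ofRealCLM.contDiff.comp b.contDiff_normed
  have hηs : HasCompactSupport η := b.hasCompactSupport_normed.comp_left Complex.ofReal_zero
  have hη1 : ∫ x, η x = 1 := by
    have := b.integral_normed (μ := volume)
    simp only [η]
    rw [integral_complex_ofReal, this, Complex.ofReal_one]
  have hint : ∀ φ : ℝ → ℂ, ContDiff ℝ ∞ φ → HasCompactSupport φ →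
      Integrable fun x => u x * φ x := fun φ hφ hs =>
    by simpa [mul_comm] using hu.integrable_smul_left_of_hasCompactSupport hφ.continuous hs
  refine ⟨∫ x, u x * η x, ?_⟩
  have key : ∀ᵐ x, u x - ∫ x, u x * η x = 0 := by
    refine ae_eq_zero_of_integral_contDiff_smul_eq_zero
      (hu.sub (locallyIntegrable_const _)) fun r hr hrs => ?_
    let φ : ℝ → ℂ := fun x => (r x : ℂ)
    have hφ : ContDiff ℝ ∞ φ := Complex.ofRealCLM.contDiff.comp hr
    have hφs : HasCompactSupport φ := hrs.comp_left Complex.ofReal_zero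
    have hφi : Integrable φ := hφ.continuous.integrable_of_hasCompactSupport hφs
    have hηi : Integrable η := hη.continuous.integrable_of_hasCompactSupport hηs
    -- Subtracting a multiple of the bump `η` of mass one makes the mean zero; testing `u` against
    -- the result gives `∫ uφ = (∫ φ)(∫ uη)`.
    obtain ⟨ψ, hψ, hψs, hd⟩ := exists_testFunction_deriv_eq
      (θ := fun x => φ x - (∫ x, φ x) * η x)
      (hφ.sub (contDiff_const.mul hη)) (hφs.sub hηs.mul_left) (by
        rw [integral_sub hφi (hηi.const_mul _), integral_const_mul, hη1, mul_one, sub_self])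
    have h1 := h ψ hψ hψs
    simp only [hd, mul_sub] at h1
    rw [integral_sub (hint φ hφ hφs)
      (by simpa [mul_left_comm] using (hint η hη hηs).const_mul (∫ x, φ x))] at h1
    have e : ∫ x, u x * ((∫ x, φ x) * η x) = (∫ x, φ x) * ∫ x, u x * η x := by
      rw [← integral_const_mul]
      congr 1; ext x; ring
    rw [e] at h1
    have e2 : ∀ x, r x • (u x - ∫ x, u x * η x) = u x * φ x - φ x * ∫ x, u x * η x := fun x => by
      simp only [Complex.real_smul, φ]; ring
    simp only [e2]
    rw [integral_sub (hint φ hφ hφs) (hφi.mul_const _), integral_mul_const, h1]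
  filter_upwards [key] with x hx using sub_eq_zero.1 hx

theorem contDiff_ofReal_complex : ContDiff ℝ ∞ fun x : ℝ => (x : ℂ) :=
  Complex.ofRealCLM.contDiff

theorem contDiff_gaussian (α : ℂ) : ContDiff ℝ ∞ fun x : ℝ => Complex.exp (-α * (x : ℂ) ^ 2 / 2) :=
  ((contDiff_const.mul (contDiff_ofReal_complex.pow 2)).div_const 2).cexp

theorem hasDerivAt_gaussian (α : ℂ) (x : ℝ) :
    HasDerivAt (fun x : ℝ => Complex.exp (-α * (x : ℂ) ^ 2 / 2))
      (-α * (x : ℂ) * Complex.exp (-α * (x : ℂ) ^ 2 / 2)) x := by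
  have h := ((((hasDerivAt_id (x : ℂ)).pow 2).const_mul (-α)).div_const 2).cexp.comp_ofReal
  refine h.congr_deriv ?_
  simp
  ring

/-- The weak `L²` solutions of `h' + α x h = 0` are the multiples of a Gaussian. -/
theorem L2R.ae_eq_gaussian (α : ℂ) (h : L2R)
    (H : ∀ φ : ℝ → ℂ, ContDiff ℝ ∞ φ → HasCompactSupport φ →
      ∫ x : ℝ, h x * (α * x * φ x - deriv φ x) = 0) :
    ∃ κ : ℂ, ∀ᵐ x : ℝ, h x = κ * Complex.exp (-α * (x : ℂ) ^ 2 / 2) := by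
  -- Integrating factor: `e^{αx²/2} h` has vanishing weak derivative, as seen by testing with
  -- `e^{αx²/2} ψ`.
  have hc := contDiff_gaussian (-α)
  have hl : LocallyIntegrable (fun x : ℝ => h x * Complex.exp (- -α * (x : ℂ) ^ 2 / 2)) := by
    have := ((Lp.memLp h).locallyIntegrable (by norm_num)).continuous_smul hc.continuous
    simpa [mul_comm] using this
  obtain ⟨κ, hκ⟩ := ae_eq_const_of_integral_mul_deriv_eq_zero hl fun ψ hψ hψs => by
    have h1 := H (fun x => Complex.exp (- -α * (x : ℂ) ^ 2 / 2) * ψ x) (hc.mul hψ) hψs.mul_left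
    rw [← neg_eq_zero, ← integral_neg, ← h1]
    congr 1; ext x
    have hd := (hasDerivAt_gaussian (-α) x).mul (hψ.differentiable (by simp) x).hasDerivAt
    rw [show deriv (fun x : ℝ => Complex.exp (- -α * (x : ℂ) ^ 2 / 2) * ψ x) x = _ from hd.deriv]
    ring
  refine ⟨κ, ?_⟩
  filter_upwards [hκ] with x hx
  rw [← hx, mul_assoc, ← Complex.exp_add]
  ring_nf
  simp

/-! ### The form domain as a Hilbert space -/

theorem inner_toLp {u : ℝ → ℂ} (hu : MemLp u 2 volume) (f : L2R) :
    inner ℂ (hu.toLp u) f = ∫ x, conj (u x) * f x := by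
  rw [← integral_mul_conj_eq_inner]
  refine integral_congr_ae ?_
  filter_upwards [hu.coeFn_toLp] with x hx
  rw [hx, mul_comm]

theorem continuous_integral_mul {u : ℝ → ℂ} (hu : MemLp u 2 volume) :
    Continuous fun f : L2R => ∫ x, f x * u x := by
  have e : (fun f : L2R => ∫ x, f x * u x) = fun f => inner ℂ (hu.star.toLp _) f := by
    ext f
    rw [inner_toLp]
    simp [mul_comm]
  rw [e]
  fun_prop

theorem isClosed_weakDerivGraph : IsClosed (weakDerivGraph : Set (L2R × L2R)) := by
  have : (weakDerivGraph : Set (L2R × L2R)) = ⋂ (φ : ℝ → ℂ) (_ : ContDiff ℝ ∞ φ)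
      (_ : HasCompactSupport φ), {p | ∫ x, p.1 x * deriv φ x = - ∫ x, p.2 x * φ x} := by
    ext p
    simp only [Set.mem_iInter, Set.mem_ofPred_eq]
    rfl
  rw [this]
  refine isClosed_iInter fun φ => isClosed_iInter fun hφ => isClosed_iInter fun hs => ?_
  exact isClosed_eq
    ((continuous_integral_mul (memLp_deriv_testFunction hφ hs)).comp continuous_fst)
    ((continuous_integral_mul (memLp_testFunction hφ hs)).comp continuous_snd).neg

/-- The graph of multiplication by `x` in `L²(ℝ)`. -/
def positionGraph : Submodule ℂ (L2R × L2R) where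
  carrier := {p | p.2 =ᵐ[volume] fun x : ℝ => (x : ℂ) * p.1 x}
  zero_mem' := by
    have h : ((0 : L2R) : ℝ → ℂ) =ᵐ[volume] 0 := Lp.coeFn_zero ℂ 2 volume
    change ((0 : L2R) : ℝ → ℂ) =ᵐ[volume] fun x : ℝ => (x : ℂ) * (0 : L2R) x
    filter_upwards [h] with x hx
    simp
  add_mem' := by
    intro p q hp hq
    change ((p.2 + q.2 : L2R) : ℝ → ℂ) =ᵐ[volume] fun x : ℝ => (x : ℂ) * (p.1 + q.1 : L2R) x
    filter_upwards [hp, hq, Lp.coeFn_add p.1 q.1, Lp.coeFn_add p.2 q.2] with x h1 h2 h3 h4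
    rw [h3, h4, Pi.add_apply, Pi.add_apply, h1, h2, mul_add]
  smul_mem' := by
    intro a p hp
    change ((a • p.2 : L2R) : ℝ → ℂ) =ᵐ[volume] fun x : ℝ => (x : ℂ) * (a • p.1 : L2R) x
    filter_upwards [hp, Lp.coeFn_smul a p.1, Lp.coeFn_smul a p.2] with x h1 h3 h4
    rw [h3, h4, Pi.smul_apply, Pi.smul_apply, h1, smul_eq_mul, smul_eq_mul, mul_left_comm]

theorem memLp_position_testFunction {φ : ℝ → ℂ} (hφ : ContDiff ℝ ∞ φ) (hs : HasCompactSupport φ) :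
    MemLp (fun x : ℝ => (x : ℂ) * φ x) 2 volume :=
  memLp_testFunction (contDiff_ofReal_complex.mul hφ) hs.mul_left

/-- In tested form each condition is an equality of `L²`-continuous functionals, so the graph is
visibly closed. -/
theorem mem_positionGraph_iff (p : L2R × L2R) : p ∈ positionGraph ↔
    ∀ φ : ℝ → ℂ, ContDiff ℝ ∞ φ → HasCompactSupport φ →
      ∫ x : ℝ, p.1 x * ((x : ℂ) * φ x) = ∫ x, p.2 x * φ x := by
  constructor
  · intro h φ _ _
    refine integral_congr_ae ?_
    filter_upwards [h] with x hx
    rw [hx]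
    ring
  · intro h
    have hl1 : LocallyIntegrable fun x : ℝ => (x : ℂ) * p.1 x :=
      ((Lp.memLp p.1).locallyIntegrable (by norm_num)).continuous_smul Complex.continuous_ofReal
    have hl2 : LocallyIntegrable p.2 := (Lp.memLp p.2).locallyIntegrable (by norm_num)
    have := ae_eq_zero_of_integral_contDiff_smul_eq_zero (hl2.sub hl1) fun r hr hrs => by
      have hφ : ContDiff ℝ ∞ fun x => (r x : ℂ) := Complex.ofRealCLM.contDiff.comp hr
      have hφs : HasCompactSupport fun x => (r x : ℂ) := hrs.comp_left Complex.ofReal_zero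
      have h1 := h _ hφ hφs
      have i1 := p.1.integrable_mul (memLp_position_testFunction hφ hφs)
      have i2 := p.2.integrable_mul (memLp_testFunction hφ hφs)
      rw [eq_comm, ← sub_eq_zero, ← integral_sub i2 i1] at h1
      rw [← h1]
      refine integral_congr_ae (Filter.Eventually.of_forall fun x => ?_)
      simp only [Pi.sub_apply, Complex.real_smul]
      ring
    filter_upwards [this] with x hx using sub_eq_zero.1 hx

theorem isClosed_positionGraph : IsClosed (positionGraph : Set (L2R × L2R)) := by
  have : (positionGraph : Set (L2R × L2R)) = ⋂ (φ : ℝ → ℂ) (_ : ContDiff ℝ ∞ φ)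
      (_ : HasCompactSupport φ),
      {p | ∫ x : ℝ, p.1 x * ((x : ℂ) * φ x) = ∫ x, p.2 x * φ x} := by
    ext p
    simp only [Set.mem_iInter, Set.mem_ofPred_eq]
    exact mem_positionGraph_iff p
  rw [this]
  refine isClosed_iInter fun φ => isClosed_iInter fun hφ => isClosed_iInter fun hs => ?_
  exact isClosed_eq
    ((continuous_integral_mul (memLp_position_testFunction hφ hs)).comp continuous_fst)
    ((continuous_integral_mul (memLp_testFunction hφ hs)).comp continuous_snd)

/-- Triples of square integrable functions. -/
abbrev L2Triple : Type := PiLp 2 fun _ : Fin 3 => L2R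

/-- The triples `(f, f', x f)`, `f` in the form domain. -/
def formSpace : Submodule ℂ L2Triple where
  carrier := {w | (w 0, w 1) ∈ weakDerivGraph ∧ (w 0, w 2) ∈ positionGraph}
  zero_mem' := ⟨weakDerivGraph.zero_mem, positionGraph.zero_mem⟩
  add_mem' h k := ⟨weakDerivGraph.add_mem h.1 k.1, positionGraph.add_mem h.2 k.2⟩
  smul_mem' a _ h := ⟨weakDerivGraph.smul_mem a h.1, positionGraph.smul_mem a h.2⟩

theorem isClosed_formSpace : IsClosed (formSpace : Set L2Triple) :=
  (isClosed_weakDerivGraph.preimage (f := fun w : L2Triple => (w 0, w 1)) (by fun_prop)).inter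
    (isClosed_positionGraph.preimage (f := fun w : L2Triple => (w 0, w 2)) (by fun_prop))

/-- Completeness supports the adjoints, the Riesz representation and the Lax–Milgram argument below.
-/
instance : CompleteSpace formSpace := isClosed_formSpace.completeSpace_coe

namespace formSpace

/-- The components of `(f, f', x f)`. -/
def comp (i : Fin 3) : formSpace →L[ℂ] L2R :=
  (PiLp.proj 2 (fun _ : Fin 3 => L2R) i).comp formSpace.subtypeL

theorem inner_eq (v w : formSpace) : inner ℂ v w =
    inner ℂ (comp 0 v) (comp 0 w) + inner ℂ (comp 1 v) (comp 1 w)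
      + inner ℂ (comp 2 v) (comp 2 w) := by
  rw [Submodule.coe_inner, PiLp.inner_apply, Fin.sum_univ_three]
  rfl

theorem norm_sq_eq (w : formSpace) :
    ‖w‖ ^ 2 = ‖comp 0 w‖ ^ 2 + ‖comp 1 w‖ ^ 2 + ‖comp 2 w‖ ^ 2 := by
  rw [Submodule.coe_norm, PiLp.norm_sq_eq_of_L2, Fin.sum_univ_three]
  rfl

theorem comp_two_ae (w : formSpace) : comp 2 w =ᵐ[volume] fun x : ℝ => (x : ℂ) * comp 0 w x :=
  w.2.2

theorem integral_comp_mul_deriv (w : formSpace) {φ : ℝ → ℂ} (hφ : ContDiff ℝ ∞ φ)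
    (hs : HasCompactSupport φ) : ∫ x, comp 0 w x * deriv φ x = - ∫ x, comp 1 w x * φ x :=
  w.2.1 φ hφ hs

theorem comp_zero_mem (w : formSpace) : comp 0 w ∈ formDomain := by
  refine ⟨LinearPMap.mem_domain_of_mem_graph ((mem_graph_weakDeriv (comp 0 w, comp 1 w)).2 w.2.1),
    (memLp_position_iff _).1 ?_⟩
  exact (memLp_congr_ae (comp_two_ae w)).1 (Lp.memLp _)

theorem formDeriv_eq (w : formSpace) : formDeriv ⟨comp 0 w, comp_zero_mem w⟩ = comp 1 w := by
  obtain ⟨y, h1, h2⟩ := (LinearPMap.mem_graph_iff _).1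
    ((mem_graph_weakDeriv (comp 0 w, comp 1 w)).2 w.2.1)
  refine Eq.trans ?_ h2
  exact congrArg weakDeriv (Subtype.ext h1.symm)

theorem exists_comp_zero_eq (f : formDomain) : ∃ w : formSpace, comp 0 w = f := by
  refine ⟨⟨WithLp.toLp 2 ![(f : L2R), formDeriv f, ((memLp_position_iff f).2 f.2.2).toLp _], ?_, ?_⟩,
    rfl⟩
  · exact (mem_graph_weakDeriv _).1 (LinearPMap.mem_graph weakDeriv ⟨f, f.2.1⟩)
  · exact ((memLp_position_iff f).2 f.2.2).coeFn_toLp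

theorem ext_comp_zero {v w : formSpace} (h : comp 0 v = comp 0 w) : v = w := by
  have h1 : comp 1 v = comp 1 w := by
    rw [← formDeriv_eq, ← formDeriv_eq]
    exact congrArg formDeriv (Subtype.ext h)
  have h2 : comp 2 v = comp 2 w := by
    refine Lp.ext ((comp_two_ae v).trans ?_)
    rw [h]
    exact (comp_two_ae w).symm
  refine Subtype.ext (PiLp.ext fun i => ?_)
  fin_cases i
  exacts [h, h1, h2]

theorem oscForm_eq (c : ℂ) (f v : formSpace) :
    oscForm c ⟨comp 0 f, comp_zero_mem f⟩ ⟨comp 0 v, comp_zero_mem v⟩ =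
      inner ℂ (comp 1 v) (comp 1 f) + c * inner ℂ (comp 2 v) (comp 2 f) := by
  rw [oscForm, integral_mul_conj_eq_inner, formDeriv_eq, formDeriv_eq,
    ← integral_mul_conj_eq_inner (comp 2 f)]
  congr 2
  refine integral_congr_ae ?_
  filter_upwards [comp_two_ae f, comp_two_ae v] with x h1 h2
  rw [h1, h2, map_mul, Complex.conj_ofReal]
  ring

theorem mem_graph_iff (c : ℂ) (p : L2R × L2R) : p ∈ (complexOscillator c).graph ↔
    ∃ f : formSpace, comp 0 f = p.1 ∧ ∀ v : formSpace,
      inner ℂ (comp 1 v) (comp 1 f) + c * inner ℂ (comp 2 v) (comp 2 f)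
        = inner ℂ (comp 0 v) p.2 := by
  rw [mem_graph_complexOscillator]
  constructor
  · rintro ⟨f, hf, h⟩
    obtain ⟨w, hw⟩ := exists_comp_zero_eq f
    have hwf : f = ⟨comp 0 w, comp_zero_mem w⟩ := Subtype.ext hw.symm
    refine ⟨w, hw.trans hf, fun v => ?_⟩
    rw [← oscForm_eq, ← hwf, h]
  · rintro ⟨f, hf, h⟩
    refine ⟨⟨comp 0 f, comp_zero_mem f⟩, hf, fun v => ?_⟩
    obtain ⟨w, hw⟩ := exists_comp_zero_eq v
    have hwv : v = ⟨comp 0 w, comp_zero_mem w⟩ := Subtype.ext hw.symm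
    rw [hwv, oscForm_eq, h]

/-- The element of the form space given by a classically differentiable function. -/
def ofHasDerivAt (u u' : ℝ → ℂ) (hd : ∀ x, HasDerivAt u (u' x) x) (hu : MemLp u 2 volume)
    (hu' : MemLp u' 2 volume) (hx : MemLp (fun x : ℝ => (x : ℂ) * u x) 2 volume) : formSpace :=
  ⟨WithLp.toLp 2 ![hu.toLp u, hu'.toLp u', hx.toLp _], by
    intro ψ hψ hψs
    have e1 : ∫ x, hu.toLp u x * deriv ψ x = ∫ x, u x * deriv ψ x :=
      integral_congr_ae (by filter_upwards [hu.coeFn_toLp] with x hx; rw [hx])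
    have e2 : ∫ x, hu'.toLp u' x * ψ x = ∫ x, u' x * ψ x :=
      integral_congr_ae (by filter_upwards [hu'.coeFn_toLp] with x hx; rw [hx])
    have km := memLp_testFunction hψ hψs
    have km' := memLp_deriv_testFunction hψ hψs
    refine e1.trans (Eq.trans ?_ (congrArg Neg.neg e2).symm)
    exact integral_mul_deriv_eq_deriv_mul_of_integrable (fun x _ => hd x)
      (fun x _ => (hψ.differentiable (by simp) x).hasDerivAt)
      (hu.integrable_mul km') (hu'.integrable_mul km) (hu.integrable_mul km), by
    change hx.toLp _ =ᵐ[volume] fun x : ℝ => (x : ℂ) * hu.toLp u x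
    filter_upwards [hu.coeFn_toLp, hx.coeFn_toLp] with x h1 h2
    rw [h1, h2]⟩

/-- The element of the form space given by a test function. -/
def ofTestFunction {φ : ℝ → ℂ} (hφ : ContDiff ℝ ∞ φ) (hs : HasCompactSupport φ) : formSpace :=
  ofHasDerivAt φ (deriv φ) (fun x => (hφ.differentiable (by simp) x).hasDerivAt)
    (memLp_testFunction hφ hs) (memLp_deriv_testFunction hφ hs) (memLp_position_testFunction hφ hs)

end formSpace

/-! ### Gaussians -/

theorem norm_gaussian_sq (α : ℂ) (x : ℝ) :
    ‖Complex.exp (-α * (x : ℂ) ^ 2 / 2)‖ ^ 2 = Real.exp (-α.re * x ^ 2) := by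
  have : (-α * (x : ℂ) ^ 2 / 2).re = -α.re * x ^ 2 / 2 := by
    rw [show -α * (x : ℂ) ^ 2 / 2 = ((x ^ 2 / 2 : ℝ) : ℂ) * -α by push_cast; ring,
      Complex.re_ofReal_mul, Complex.neg_re]
    ring
  rw [Complex.norm_exp, ← Real.exp_nat_mul, this]
  congr 1
  push_cast
  ring

theorem memLp_gaussian {α : ℂ} (hα : 0 < α.re) :
    MemLp (fun x : ℝ => Complex.exp (-α * (x : ℂ) ^ 2 / 2)) 2 volume := by
  rw [memLp_two_iff_integrable_sq_norm (contDiff_gaussian α).continuous.aestronglyMeasurable]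
  simp only [norm_gaussian_sq]
  exact integrable_exp_neg_mul_sq hα

theorem memLp_position_gaussian {α : ℂ} (hα : 0 < α.re) :
    MemLp (fun x : ℝ => (x : ℂ) * Complex.exp (-α * (x : ℂ) ^ 2 / 2)) 2 volume := by
  rw [memLp_two_iff_integrable_sq_norm
    (contDiff_ofReal_complex.mul (contDiff_gaussian α)).continuous.aestronglyMeasurable]
  simp only [norm_mul, mul_pow, norm_gaussian_sq, Complex.norm_real, Real.norm_eq_abs, sq_abs]
  simpa using integrable_rpow_mul_exp_neg_mul_sq hα (s := 2) (by norm_num)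

theorem memLp_position_sq_gaussian {α : ℂ} (hα : 0 < α.re) :
    MemLp (fun x : ℝ => (x : ℂ) ^ 2 * Complex.exp (-α * (x : ℂ) ^ 2 / 2)) 2 volume := by
  rw [memLp_two_iff_integrable_sq_norm
    ((contDiff_ofReal_complex.pow 2).mul (contDiff_gaussian α)).continuous.aestronglyMeasurable]
  simp only [norm_mul, mul_pow, norm_pow, norm_gaussian_sq, Complex.norm_real, Real.norm_eq_abs,
    sq_abs]
  have := integrable_rpow_mul_exp_neg_mul_sq hα (s := 4) (by norm_num)
  refine this.congr (Filter.Eventually.of_forall fun x => ?_)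
  simp only [show (4 : ℝ) = ((4 : ℕ) : ℝ) by norm_num, Real.rpow_natCast]
  ring

namespace formSpace

/-- The Gaussian `e^{-α x² / 2}`. -/
def gaussian (α : ℂ) (hα : 0 < α.re) : formSpace :=
  ofHasDerivAt _ (fun x : ℝ => -α * (x : ℂ) * Complex.exp (-α * (x : ℂ) ^ 2 / 2))
    (hasDerivAt_gaussian α) (memLp_gaussian hα)
    (by simpa only [mul_assoc] using (memLp_position_gaussian hα).const_mul (-α))
    (memLp_position_gaussian hα)

theorem gaussian_ae (α : ℂ) (hα : 0 < α.re) :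
    comp 0 (gaussian α hα) =ᵐ[volume] fun x : ℝ => Complex.exp (-α * (x : ℂ) ^ 2 / 2) :=
  (memLp_gaussian hα).coeFn_toLp

theorem comp_one_gaussian (α : ℂ) (hα : 0 < α.re) :
    comp 1 (gaussian α hα) = -α • comp 2 (gaussian α hα) := by
  refine Lp.ext ?_
  have h1 : comp 1 (gaussian α hα) =ᵐ[volume]
      fun x : ℝ => -α * (x : ℂ) * Complex.exp (-α * (x : ℂ) ^ 2 / 2) :=
    MemLp.coeFn_toLp (f := fun x : ℝ => -α * (x : ℂ) * Complex.exp (-α * (x : ℂ) ^ 2 / 2))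
      (by simpa only [mul_assoc] using (memLp_position_gaussian hα).const_mul (-α))
  filter_upwards [h1, gaussian_ae α hα, comp_two_ae (gaussian α hα),
    Lp.coeFn_smul (-α) (comp 2 (gaussian α hα))] with x h1 h2 h3 h4
  rw [h1, h4, Pi.smul_apply, h3, h2, smul_eq_mul, mul_assoc]

theorem comp_zero_gaussian_ne_zero (α : ℂ) (hα : 0 < α.re) : comp 0 (gaussian α hα) ≠ 0 := by
  intro h
  have h1 := gaussian_ae α hα
  rw [h] at h1
  have h2 := (Lp.coeFn_zero ℂ 2 (volume : Measure ℝ)).symm.trans h1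
  obtain ⟨x, hx⟩ := h2.exists
  exact Complex.exp_ne_zero _ hx.symm

end formSpace

/-! ### Density of test functions in the form space -/

/-- Integration by parts against a smooth square integrable function with square integrable
derivative. -/
theorem integral_mul_deriv_of_memLp {f f' : L2R} (hf : (f, f') ∈ weakDerivGraph) {ψ : ℝ → ℂ}
    (hψ : ContDiff ℝ ∞ ψ) (h2 : MemLp ψ 2 volume) (h2' : MemLp (deriv ψ) 2 volume) :
    ∫ x, f x * deriv ψ x = - ∫ x, f' x * ψ x := by
  let b : ContDiffBump (0 : ℝ) := ⟨1, 2, by norm_num, by norm_num⟩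
  have hb : ContDiff ℝ ∞ b := b.contDiff
  obtain ⟨K, hK⟩ := (hb.continuous_deriv (by simp)).bounded_above_of_compact_support
    b.hasCompactSupport.deriv
  -- Dilated cut-offs: `χ n → 1` pointwise with `|χ n| ≤ 1`, while `|χ n'| ≤ K / (n + 1)`, so the
  -- extra term of the product rule disappears in the limit.
  let χ : ℕ → ℝ → ℂ := fun n x => (b (x / (n + 1)) : ℂ)
  have hχ : ∀ n, ContDiff ℝ ∞ (χ n) := fun n =>
    Complex.ofRealCLM.contDiff.comp (hb.comp (contDiff_id.div_const _))
  have hχs : ∀ n, HasCompactSupport (χ n) := fun n => by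
    have h1 : HasCompactSupport fun x : ℝ => b (x / (n + 1)) := by
      have := b.hasCompactSupport.comp_homeomorph
        (Homeomorph.mulRight₀ ((n : ℝ) + 1)⁻¹ (by positivity))
      simpa [Function.comp_def, div_eq_mul_inv] using this
    exact h1.comp_left Complex.ofReal_zero
  have hχd : ∀ n x, HasDerivAt (χ n) ((deriv b (x / (n + 1)) * (1 / (n + 1)) : ℝ) : ℂ) x :=
    fun n x => HasDerivAt.ofReal_comp
      ((hb.differentiable (by simp) _).hasDerivAt.comp x ((hasDerivAt_id x).div_const _))
  have hlim : Filter.Tendsto (fun n : ℕ => 1 / ((n : ℝ) + 1)) Filter.atTop (nhds 0) :=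
    tendsto_one_div_add_atTop_nhds_zero_nat
  have conv : ∀ F : ℝ → ℂ, Integrable F →
      Filter.Tendsto (fun n => ∫ x, F x * χ n x) Filter.atTop (nhds (∫ x, F x)) := by
    intro F hF
    refine tendsto_integral_of_dominated_convergence (fun x => ‖F x‖)
      (fun n => hF.aestronglyMeasurable.mul (hχ n).continuous.aestronglyMeasurable) hF.norm
      (fun n => Filter.Eventually.of_forall fun x => ?_) (Filter.Eventually.of_forall fun x => ?_)
    · rw [norm_mul]
      refine mul_le_of_le_one_right (norm_nonneg _) ?_
      rw [Complex.norm_real, Real.norm_of_nonneg b.nonneg]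
      exact b.le_one
    · have h1 : Filter.Tendsto (fun n : ℕ => x / ((n : ℝ) + 1)) Filter.atTop (nhds 0) := by
        simpa [div_eq_mul_inv] using hlim.const_mul x
      have h3 : Filter.Tendsto (fun n : ℕ => χ n x) Filter.atTop (nhds ((b 0 : ℝ) : ℂ)) :=
        (Complex.continuous_ofReal.tendsto _).comp ((hb.continuous.tendsto 0).comp h1)
      have h4 : b 0 = 1 := b.one_of_mem_closedBall (by simp [b])
      simpa [h4] using h3.const_mul (F x)
  have conv0 : ∀ F : ℝ → ℂ, Integrable F →
      Filter.Tendsto (fun n => ∫ x, F x * deriv (χ n) x) Filter.atTop (nhds 0) := by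
    intro F hF
    have hbd : ∀ n : ℕ, ‖∫ x, F x * deriv (χ n) x‖ ≤ (∫ x, ‖F x‖ * K) * (1 / ((n : ℝ) + 1)) := by
      intro n
      rw [← integral_mul_const]
      refine norm_integral_le_of_norm_le ((hF.norm.mul_const K).mul_const _)
        (Filter.Eventually.of_forall fun x => ?_)
      rw [norm_mul, (hχd n x).deriv, Complex.norm_real, norm_mul, mul_assoc]
      rw [Real.norm_of_nonneg (show (0 : ℝ) ≤ 1 / ((n : ℝ) + 1) by positivity)]
      gcongr
      exact hK _
    refine squeeze_zero_norm hbd ?_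
    simpa using hlim.const_mul (∫ x, ‖F x‖ * K)
  have i1 := f.integrable_mul h2'
  have i2 := f.integrable_mul h2
  have i3 := f'.integrable_mul h2
  have hn : ∀ n, (∫ x, f x * deriv ψ x * χ n x) + ∫ x, f x * ψ x * deriv (χ n) x
      = - ∫ x, f' x * ψ x * χ n x := by
    intro n
    have h := hf (fun x => ψ x * χ n x) (hψ.mul (hχ n)) (hχs n).mul_left
    have ib : ∀ F : ℝ → ℂ, Integrable F → ∀ {u : ℝ → ℂ}, Continuous u → HasCompactSupport u →
        Integrable fun x => F x * u x := fun F hF u hu hus => by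
      simpa [mul_comm] using
        hF.locallyIntegrable.integrable_smul_left_of_hasCompactSupport hu hus
    rw [← integral_add (ib _ i1 (hχ n).continuous (hχs n))
      (ib _ i2 ((hχ n).continuous_deriv (by simp)) (hχs n).deriv)]
    simp only [mul_assoc]
    rw [← h]
    congr 1; ext x
    have hd := (hψ.differentiable (by simp) x).hasDerivAt.mul
      ((hχ n).differentiable (by simp) x).hasDerivAt
    rw [show deriv (fun x => ψ x * χ n x) x = _ from hd.deriv]
    ring
  have l1 := (conv _ i1).add (conv0 _ i2)
  have l2 := (conv _ i3).neg
  simp only [hn, add_zero] at l1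
  exact tendsto_nhds_unique l1 l2

/-! ### Gaussian rigidity, density and the commutation relation -/

namespace formSpace

theorem inner_position (v w : formSpace) :
    inner ℂ (comp 2 v) (comp 0 w) = inner ℂ (comp 0 v) (comp 2 w) := by
  rw [← integral_mul_conj_eq_inner, ← integral_mul_conj_eq_inner]
  refine integral_congr_ae ?_
  filter_upwards [comp_two_ae v, comp_two_ae w] with x h2 h3
  rw [h2, h3, map_mul, Complex.conj_ofReal]
  ring

theorem inner_comp_zero_ofTestFunction {φ : ℝ → ℂ} (hφ : ContDiff ℝ ∞ φ) (hs : HasCompactSupport φ)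
    (f : L2R) : inner ℂ (comp 0 (ofTestFunction hφ hs)) f = ∫ x, f x * conj (φ x) :=
  (inner_toLp (memLp_testFunction hφ hs) _).trans (by simp only [mul_comm])

theorem inner_comp_one_ofTestFunction {φ : ℝ → ℂ} (hφ : ContDiff ℝ ∞ φ) (hs : HasCompactSupport φ)
    (f : L2R) : inner ℂ (comp 1 (ofTestFunction hφ hs)) f = ∫ x, f x * conj (deriv φ x) :=
  (inner_toLp (memLp_deriv_testFunction hφ hs) _).trans (by simp only [mul_comm])

theorem inner_comp_two_ofTestFunction {φ : ℝ → ℂ} (hφ : ContDiff ℝ ∞ φ) (hs : HasCompactSupport φ)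
    (f : L2R) : inner ℂ (comp 2 (ofTestFunction hφ hs)) f = ∫ x : ℝ, f x * ((x : ℂ) * conj (φ x)) :=
  (inner_toLp (memLp_position_testFunction hφ hs) _).trans
    (by simp only [mul_comm, map_mul, Complex.conj_ofReal])

theorem contDiff_conj {φ : ℝ → ℂ} (hφ : ContDiff ℝ ∞ φ) : ContDiff ℝ ∞ fun x => conj (φ x) :=
  Complex.conjCLE.contDiff.comp hφ

theorem deriv_conj {φ : ℝ → ℂ} (hφ : ContDiff ℝ ∞ φ) (x : ℝ) :
    deriv (fun x => conj (φ x)) x = conj (deriv φ x) :=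
  (Complex.conjCLE.toContinuousLinearMap.hasFDerivAt.comp_hasDerivAt x
    (hφ.differentiable (by simp) x).hasDerivAt).deriv

theorem inner_deriv_ofTestFunction {φ : ℝ → ℂ} (hφ : ContDiff ℝ ∞ φ) (hs : HasCompactSupport φ)
    (w : formSpace) : inner ℂ (comp 1 (ofTestFunction hφ hs)) (comp 0 w) =
      - inner ℂ (comp 0 (ofTestFunction hφ hs)) (comp 1 w) := by
  rw [inner_comp_one_ofTestFunction, inner_comp_zero_ofTestFunction]
  rw [← integral_comp_mul_deriv w (contDiff_conj hφ) (hs.comp_left (map_zero _))]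
  simp only [deriv_conj hφ]

/-- This is the definition of the weak derivative tested with `x φ̄`, whose derivative is `φ̄ + x
φ̄'`. -/
theorem inner_position_deriv_ofTestFunction {φ : ℝ → ℂ} (hφ : ContDiff ℝ ∞ φ)
    (hs : HasCompactSupport φ) (w : formSpace) :
    inner ℂ (comp 2 (ofTestFunction hφ hs)) (comp 1 w) +
      inner ℂ (comp 1 (ofTestFunction hφ hs)) (comp 2 w) +
      inner ℂ (comp 0 (ofTestFunction hφ hs)) (comp 0 w) = 0 := by
  rw [inner_comp_two_ofTestFunction, inner_comp_one_ofTestFunction, inner_comp_zero_ofTestFunction]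
  have hφc := contDiff_conj hφ
  have hsc : HasCompactSupport fun x => conj (φ x) := hs.comp_left (map_zero _)
  have h := integral_comp_mul_deriv w (contDiff_ofReal_complex.mul hφc) hsc.mul_left
  have i1 : Integrable fun x => comp 2 w x * conj (deriv φ x) :=
    (comp 2 w).integrable_mul (memLp_deriv_testFunction hφ hs).star
  have i2 : Integrable fun x => comp 0 w x * conj (φ x) :=
    (comp 0 w).integrable_mul (memLp_testFunction hφ hs).star
  have e : ∀ᵐ x : ℝ, comp 0 w x * deriv (fun x : ℝ => (x : ℂ) * conj (φ x)) x =
      comp 2 w x * conj (deriv φ x) + comp 0 w x * conj (φ x) := by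
    filter_upwards [comp_two_ae w] with x hx
    have hd := (Complex.ofRealCLM.hasDerivAt (x := x)).mul
      (hφc.differentiable (by simp) x).hasDerivAt
    rw [show deriv (fun x : ℝ => (x : ℂ) * conj (φ x)) x = _ from hd.deriv, deriv_conj hφ, hx]
    simp
    ring
  rw [integral_congr_ae e, integral_add i1 i2] at h
  rw [add_assoc, h, add_neg_cancel]

/-- A square integrable function which is orthogonal to the range of `x - d/dx` on test functions
is a multiple of a Gaussian. -/
theorem ae_eq_gaussian_of_inner_eq_zero (a : ℝ) (h : L2R)
    (H : ∀ (φ : ℝ → ℂ) (hφ : ContDiff ℝ ∞ φ) (hs : HasCompactSupport φ),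
      inner ℂ (a • comp 2 (ofTestFunction hφ hs) - comp 1 (ofTestFunction hφ hs)) h = 0) :
    ∃ κ : ℂ, ∀ᵐ x : ℝ, h x = κ * Complex.exp (-(a : ℂ) * (x : ℂ) ^ 2 / 2) := by
  refine h.ae_eq_gaussian a fun φ hφ hs => ?_
  have hφc := contDiff_conj hφ
  have hsc : HasCompactSupport fun x => conj (φ x) := hs.comp_left (map_zero _)
  have h1 := H _ hφc hsc
  rw [inner_sub_left, inner_smul_left_eq_smul, inner_comp_two_ofTestFunction,
    inner_comp_one_ofTestFunction, Complex.real_smul, ← integral_const_mul, ← integral_sub] at h1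
  · rw [← h1]
    congr 1; ext x
    rw [deriv_conj hφ, Complex.conj_conj, Complex.conj_conj]
    ring
  · refine Integrable.const_mul ?_ _
    simpa using h.integrable_mul (memLp_position_testFunction hφ hs)
  · simp only [deriv_conj hφ, Complex.conj_conj]
    exact h.integrable_mul (memLp_deriv_testFunction hφ hs)

theorem eq_smul_gaussian_of_inner_eq_zero {a : ℝ} (ha : 0 < (a : ℂ).re) (h : L2R)
    (H : ∀ (φ : ℝ → ℂ) (hφ : ContDiff ℝ ∞ φ) (hs : HasCompactSupport φ),
      inner ℂ (a • comp 2 (ofTestFunction hφ hs) - comp 1 (ofTestFunction hφ hs)) h = 0) :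
    ∃ κ : ℂ, h = κ • comp 0 (gaussian a ha) := by
  obtain ⟨κ, hκ⟩ := ae_eq_gaussian_of_inner_eq_zero a h H
  refine ⟨κ, Lp.ext ?_⟩
  filter_upwards [hκ, gaussian_ae a ha, Lp.coeFn_smul κ (comp 0 (gaussian a ha))] with x h1 h2 h3
  rw [h1, h3, Pi.smul_apply, h2, smul_eq_mul]

/-- Since `e^{x²/2} ≥ 1`, the constant `κ` is dominated by `h`, and a nonzero constant is not square
integrable on the line. -/
theorem eq_zero_of_ae_eq_growing_gaussian (h : L2R) {κ : ℂ}
    (hκ : ∀ᵐ x : ℝ, h x = κ * Complex.exp (-((-1 : ℝ) : ℂ) * (x : ℂ) ^ 2 / 2)) : h = 0 := by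
  have h1 : MemLp (fun _ : ℝ => κ) 2 volume := by
    refine (Lp.memLp h).of_le aestronglyMeasurable_const ?_
    filter_upwards [hκ] with x hx
    rw [hx, norm_mul, Complex.norm_exp]
    refine le_mul_of_one_le_right (norm_nonneg _) (Real.one_le_exp ?_)
    rw [show -((-1 : ℝ) : ℂ) * (x : ℂ) ^ 2 / 2 = ((x ^ 2 / 2 : ℝ) : ℂ) by push_cast; ring,
      Complex.ofReal_re]
    positivity
  rw [memLp_const_iff (by norm_num) (by norm_num)] at h1
  have h2 : κ = 0 := by simpa using h1
  rw [Lp.eq_zero_iff_ae_eq_zero]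
  filter_upwards [hκ] with x hx
  simp [hx, h2]

/-- The Gaussian is not compactly supported, so this uses the cut-off argument; the general
`inner_deriv` depends on the density that this lemma helps to prove. -/
theorem inner_deriv_gaussian (w : formSpace) {a : ℝ} (ha : 0 < (a : ℂ).re) :
    inner ℂ (comp 1 (gaussian a ha)) (comp 0 w) = - inner ℂ (comp 0 (gaussian a ha)) (comp 1 w) := by
  have hc := contDiff_conj (contDiff_gaussian a)
  have hd : ∀ x : ℝ, deriv (fun x : ℝ => conj (Complex.exp (-(a : ℂ) * (x : ℂ) ^ 2 / 2))) x =
      conj (-(a : ℂ) * (x : ℂ) * Complex.exp (-(a : ℂ) * (x : ℂ) ^ 2 / 2)) := fun x => by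
    rw [deriv_conj (contDiff_gaussian a), (hasDerivAt_gaussian a x).deriv]
  have hm : MemLp (fun x : ℝ => -(a : ℂ) * (x : ℂ) * Complex.exp (-(a : ℂ) * (x : ℂ) ^ 2 / 2)) 2
      volume := by simpa only [mul_assoc] using (memLp_position_gaussian ha).const_mul (-(a : ℂ))
  have h := integral_mul_deriv_of_memLp w.2.1 hc (memLp_gaussian ha).star
    (by rw [funext hd]; exact hm.star)
  simp only [hd] at h
  refine ((inner_toLp hm _).trans ?_).trans (h.trans (congrArg Neg.neg ?_))
  · exact integral_congr_ae (Filter.Eventually.of_forall fun x => mul_comm _ _)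
  · exact (((inner_toLp (memLp_gaussian ha) _).trans
      (integral_congr_ae (Filter.Eventually.of_forall fun x => mul_comm _ _)))).symm

/-- Only zero is orthogonal to all test functions in the form space. -/
theorem eq_zero_of_inner_ofTestFunction_eq_zero (w : formSpace)
    (hw : ∀ (φ : ℝ → ℂ) (hφ : ContDiff ℝ ∞ φ) (hs : HasCompactSupport φ),
      inner ℂ (ofTestFunction hφ hs) w = 0) : w = 0 := by
  have h1 : 0 < ((1 : ℝ) : ℂ).re := by simp
  -- Subtracting the commutation relation from `⟨φ, w⟩ = 0` factors it as `⟨xφ - φ', xw - w'⟩ = 0`.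
  obtain ⟨κ, hκ⟩ := eq_smul_gaussian_of_inner_eq_zero h1 (comp 2 w - comp 1 w) fun φ hφ hs => by
    have e1 := hw φ hφ hs
    have e2 := inner_position_deriv_ofTestFunction hφ hs w
    rw [inner_eq] at e1
    rw [one_smul, inner_sub_left, inner_sub_right, inner_sub_right]
    linear_combination e1 - e2
  -- With `g` the Gaussian, moving the operator across gives `⟨xg + g', w⟩`, and `g' = -xg`. Thus
  -- `κ` must vanish.
  have hB : inner ℂ (comp 0 (gaussian _ h1)) (comp 2 w - comp 1 w) = 0 := by
    have e1 := inner_deriv_gaussian w h1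
    have e2 := inner_position (gaussian _ h1) w
    rw [comp_one_gaussian, inner_smul_left, e2] at e1
    simp only [Complex.ofReal_one, map_neg, map_one, neg_mul, one_mul, neg_inj] at e1
    rw [inner_sub_right, sub_eq_zero]
    simpa using e1
  have hκ0 : comp 2 w - comp 1 w = 0 := by
    rw [hκ, inner_smul_right, mul_eq_zero, inner_self_eq_zero] at hB
    rcases hB with hB | hB
    · rw [hκ, hB, zero_smul]
    · exact absurd hB (comp_zero_gaussian_ne_zero _ h1)
  -- Now `w' = xw`, so `w` is a multiple of the growing `e^{x²/2}`.
  obtain ⟨C, hC⟩ := ae_eq_gaussian_of_inner_eq_zero (-1) (comp 0 w) fun φ hφ hs => by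
    have e1 := inner_deriv_ofTestFunction hφ hs w
    have e2 := inner_position (ofTestFunction hφ hs) w
    rw [neg_one_smul, inner_sub_left, inner_neg_left, e1, e2, sub_eq_zero.1 hκ0]
    ring
  refine ext_comp_zero ?_
  rw [map_zero]
  exact eq_zero_of_ae_eq_growing_gaussian _ hC

/-- A continuous linear functional on the form space vanishing on test functions is zero. -/
theorem eq_zero_of_ofTestFunction_eq_zero (ℓ : formSpace →L[ℂ] ℂ)
    (h : ∀ (φ : ℝ → ℂ) (hφ : ContDiff ℝ ∞ φ) (hs : HasCompactSupport φ),
      ℓ (ofTestFunction hφ hs) = 0) : ℓ = 0 := by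
  obtain ⟨w, rfl⟩ := (InnerProductSpace.toDual ℂ formSpace).surjective ℓ
  have : w = 0 := eq_zero_of_inner_ofTestFunction_eq_zero w fun φ hφ hs =>
    (inner_eq_zero_symm (𝕜 := ℂ) (E := formSpace)).1 (h φ hφ hs)
  rw [this, LinearIsometryEquiv.map_zero]

theorem inner_deriv (v w : formSpace) :
    inner ℂ (comp 1 v) (comp 0 w) = - inner ℂ (comp 0 v) (comp 1 w) := by
  -- The density lemma needs functionals linear in `v`, so the identity is proved in conjugated
  -- form.
  have := eq_zero_of_ofTestFunction_eq_zero
    ((innerSL ℂ (comp 0 w)).comp (comp 1) + (innerSL ℂ (comp 1 w)).comp (comp 0))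
    fun φ hφ hs => by
      have := congrArg conj (inner_deriv_ofTestFunction hφ hs w)
      rw [map_neg, inner_conj_symm, inner_conj_symm] at this
      simp [this]
  have h := congrArg conj (DFunLike.congr_fun this v)
  simp only [add_apply, ContinuousLinearMap.comp_apply, innerSL_apply_apply,
    map_add, inner_conj_symm, zero_apply, map_zero] at h
  linear_combination h

/-- The canonical commutation relation in the form sense. -/
theorem inner_position_deriv (v w : formSpace) :
    inner ℂ (comp 2 v) (comp 1 w) + inner ℂ (comp 1 v) (comp 2 w) +
      inner ℂ (comp 0 v) (comp 0 w) = 0 := by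
  have := eq_zero_of_ofTestFunction_eq_zero
    ((innerSL ℂ (comp 1 w)).comp (comp 2) + (innerSL ℂ (comp 2 w)).comp (comp 1) +
      (innerSL ℂ (comp 0 w)).comp (comp 0))
    fun φ hφ hs => by
      have := congrArg conj (inner_position_deriv_ofTestFunction hφ hs w)
      rw [map_add, map_add, inner_conj_symm, inner_conj_symm, inner_conj_symm, map_zero] at this
      simpa using this
  have h := congrArg conj (DFunLike.congr_fun this v)
  simpa only [add_apply, ContinuousLinearMap.comp_apply, innerSL_apply_apply,
    map_add, inner_conj_symm, zero_apply, map_zero] using h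


/-! ### The numerical range -/

/-- The Heisenberg uncertainty principle. -/
theorem norm_sq_le_two_mul (f : formSpace) : ‖comp 0 f‖ ^ 2 ≤ 2 * (‖comp 1 f‖ * ‖comp 2 f‖) := by
  have h := inner_position_deriv f f
  have h1 : ‖inner ℂ (comp 0 f) (comp 0 f)‖ =
      ‖inner ℂ (comp 2 f) (comp 1 f) + inner ℂ (comp 1 f) (comp 2 f)‖ := by
    rw [← norm_neg, ← eq_neg_of_add_eq_zero_left h]
  rw [inner_self_eq_norm_sq_to_K] at h1
  have h2 := norm_inner_le_norm (𝕜 := ℂ) (comp 2 f) (comp 1 f)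
  have h3 := norm_inner_le_norm (𝕜 := ℂ) (comp 1 f) (comp 2 f)
  have h4 := norm_add_le (inner ℂ (comp 2 f) (comp 1 f)) (inner ℂ (comp 1 f) (comp 2 f))
  have h5 : ‖comp 0 f‖ ^ 2 = ‖((‖comp 0 f‖ : ℂ)) ^ 2‖ := by simp
  rw [h5]
  refine h1.le.trans ?_
  linarith

/-- Since `g' = -αxg`, the commutation relation trades `⟨v', g'⟩` for `α⟨v, g⟩ - α²⟨xv, xg⟩`. -/
theorem inner_deriv_gaussian_add (c α : ℂ) (hα : 0 < α.re) (v : formSpace) :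
    inner ℂ (comp 1 v) (comp 1 (gaussian α hα)) + c * inner ℂ (comp 2 v) (comp 2 (gaussian α hα)) =
      α * inner ℂ (comp 0 v) (comp 0 (gaussian α hα)) +
        (c - α ^ 2) * inner ℂ (comp 2 v) (comp 2 (gaussian α hα)) := by
  have h := inner_position_deriv v (gaussian α hα)
  rw [comp_one_gaussian, inner_smul_right] at h ⊢
  linear_combination (-α) * h

theorem gaussian_mem_graph (c α : ℂ) (hα : 0 < α.re) :
    (comp 0 (gaussian α hα), α • comp 0 (gaussian α hα) +
      (c - α ^ 2) • (memLp_position_sq_gaussian hα).toLp _) ∈ (complexOscillator c).graph := by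
  refine (mem_graph_iff c _).2 ⟨gaussian α hα, rfl, fun v => ?_⟩
  have h2 : inner ℂ (comp 2 v) (comp 2 (gaussian α hα)) =
      inner ℂ (comp 0 v) ((memLp_position_sq_gaussian hα).toLp _) := by
    rw [← integral_mul_conj_eq_inner, ← integral_mul_conj_eq_inner]
    refine integral_congr_ae ?_
    filter_upwards [comp_two_ae v, comp_two_ae (gaussian α hα), gaussian_ae α hα,
      (memLp_position_sq_gaussian hα).coeFn_toLp] with x h1 h2 h3 h4
    rw [h1, h2, h3, h4, map_mul, Complex.conj_ofReal]
    ring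
  rw [inner_deriv_gaussian_add, inner_add_right, inner_smul_right, inner_smul_right, h2]

/-- The commutation relation with `g' = -αxg` gives the ratio without evaluating an integral. -/
theorem norm_position_gaussian (α : ℂ) (hα : 0 < α.re) :
    2 * α.re * ‖comp 2 (gaussian α hα)‖ ^ 2 = ‖comp 0 (gaussian α hα)‖ ^ 2 := by
  have h := inner_position_deriv (gaussian α hα) (gaussian α hα)
  rw [comp_one_gaussian, inner_smul_left, inner_smul_right, inner_self_eq_norm_sq_to_K,
    inner_self_eq_norm_sq_to_K] at h
  have h' := congrArg Complex.re h
  simp [← Complex.ofReal_pow] at h'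
  linarith

theorem norm_deriv_gaussian (α : ℂ) (hα : 0 < α.re) :
    ‖comp 1 (gaussian α hα)‖ ^ 2 = ‖α‖ ^ 2 * ‖comp 2 (gaussian α hα)‖ ^ 2 := by
  rw [comp_one_gaussian, norm_smul, norm_neg, mul_pow]

theorem mem_numRange_iff (c z : ℂ) : z ∈ numRange (complexOscillator c) ↔
    ∃ (f : formSpace) (h : L2R), (comp 0 f, h) ∈ (complexOscillator c).graph ∧ ‖comp 0 f‖ = 1 ∧
      z = (‖comp 1 f‖ ^ 2 : ℝ) + c * (‖comp 2 f‖ ^ 2 : ℝ) := by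
  have key : ∀ (f : formSpace) (h : L2R), (comp 0 f, h) ∈ (complexOscillator c).graph →
      inner ℂ (comp 0 f) h = (‖comp 1 f‖ ^ 2 : ℝ) + c * (‖comp 2 f‖ ^ 2 : ℝ) := by
    intro f h hf
    obtain ⟨w, hw, hv⟩ := (mem_graph_iff c _).1 hf
    obtain rfl := ext_comp_zero hw
    rw [← hv w, inner_self_eq_norm_sq_to_K, inner_self_eq_norm_sq_to_K]
    push_cast
    rfl
  constructor
  · rintro ⟨x, hx, rfl⟩
    have hg := LinearPMap.mem_graph (complexOscillator c) x
    obtain ⟨f, hf, -⟩ := (mem_graph_iff c _).1 hg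
    change comp 0 f = (x : L2R) at hf
    rw [← hf] at hg hx ⊢
    exact ⟨f, _, hg, hx, key f _ hg⟩
  · rintro ⟨f, h, hf, h1, rfl⟩
    obtain ⟨y, hy1, hy2⟩ := (LinearPMap.mem_graph_iff _).1 hf
    refine ⟨y, ?_, ?_⟩
    · rw [hy1, h1]
    · rw [hy1, hy2, key f h hf]

theorem numRange_complexOscillator (c : ℂ) :
    numRange (complexOscillator c) =
      {z : ℂ | ∃ t₁ t₂ : ℝ, 0 ≤ t₁ ∧ 0 ≤ t₂ ∧ 1 / 4 ≤ t₁ * t₂ ∧ z = t₁ + c * t₂} := by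
  ext z
  rw [mem_numRange_iff]
  constructor
  · rintro ⟨f, h, -, h1, rfl⟩
    refine ⟨_, _, sq_nonneg _, sq_nonneg _, ?_, rfl⟩
    have hu := norm_sq_le_two_mul f
    rw [h1] at hu
    nlinarith
  · rintro ⟨t₁, t₂, h1, h2, h12, rfl⟩
    have ht2 : 0 < t₂ := lt_of_le_of_ne h2 fun h => by
      rw [← h, mul_zero] at h12
      norm_num at h12
    -- The ratio `‖xg‖²/‖g‖² = 1/(2 Re α)` must be `t₂`, and `‖g'‖²/‖xg‖² = |α|²` must be `t₁/t₂`.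
    -- The resulting square root is real exactly because `t₁t₂ ≥ 1/4`.
    let α : ℂ := ⟨1 / (2 * t₂), √(4 * (t₁ * t₂) - 1) / (2 * t₂)⟩
    have hα : 0 < α.re := by
      change 0 < 1 / (2 * t₂)
      positivity
    have hn : ‖α‖ ^ 2 = t₁ / t₂ := by
      rw [Complex.sq_norm, Complex.normSq_apply]
      have := Real.mul_self_sqrt (show 0 ≤ 4 * (t₁ * t₂) - 1 by linarith)
      change 1 / (2 * t₂) * (1 / (2 * t₂)) + √(4 * (t₁ * t₂) - 1) / (2 * t₂) *
        (√(4 * (t₁ * t₂) - 1) / (2 * t₂)) = _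
      generalize √(4 * (t₁ * t₂) - 1) = s at this ⊢
      field_simp
      linarith
    have hg0 : 0 < ‖comp 0 (gaussian α hα)‖ := norm_pos_iff.2 (comp_zero_gaussian_ne_zero α hα)
    have hp2 : ‖comp 2 (gaussian α hα)‖ ^ 2 = t₂ * ‖comp 0 (gaussian α hα)‖ ^ 2 := by
      rw [← norm_position_gaussian]
      change _ = t₂ * (2 * (1 / (2 * t₂)) * _)
      field_simp
    have hp1 : ‖comp 1 (gaussian α hα)‖ ^ 2 = t₁ * ‖comp 0 (gaussian α hα)‖ ^ 2 := by
      rw [norm_deriv_gaussian, hn, hp2]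
      field_simp
    let s : ℂ := (‖comp 0 (gaussian α hα)‖⁻¹ : ℝ)
    have hs : ‖s‖ = ‖comp 0 (gaussian α hα)‖⁻¹ := by
      simp [s]
    have hg := (complexOscillator c).graph.smul_mem s (gaussian_mem_graph c α hα)
    refine ⟨s • gaussian α hα, _, by rw [map_smul]; exact hg, ?_, ?_⟩
    · rw [map_smul, norm_smul, hs, inv_mul_cancel₀ hg0.ne']
    · rw [map_smul, map_smul, norm_smul, norm_smul, mul_pow, mul_pow, hs, hp1, hp2]
      congr 3 <;> field_simp

/-! ### The spectral gap above the Gaussian ground state -/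

theorem re_inner_position_deriv (f : formSpace) :
    2 * (inner ℂ (comp 2 f) (comp 1 f)).re = - ‖comp 0 f‖ ^ 2 := by
  have h := congrArg Complex.re (inner_position_deriv f f)
  have hs : (inner ℂ (comp 1 f) (comp 2 f)).re = (inner ℂ (comp 2 f) (comp 1 f)).re :=
    inner_re_symm (𝕜 := ℂ) _ _
  rw [inner_self_eq_norm_sq_to_K] at h
  simp [← Complex.ofReal_pow] at h
  linarith

/-- The annihilation operator `a x + d/dx`. -/
def annihilation (a : ℝ) : formSpace →L[ℂ] L2R := (a : ℂ) • comp 2 + comp 1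

/-- The creation operator `a x - d/dx`. -/
def creation (a : ℝ) : formSpace →L[ℂ] L2R := (a : ℂ) • comp 2 - comp 1

/-- The cross term `2a Re⟨xf, f'⟩` equals `-a‖f‖²`. The creation operator has the opposite sign, so
the two squares differ by `2a‖f‖²`. -/
theorem norm_annihilation_sq (a : ℝ) (f : formSpace) :
    ‖annihilation a f‖ ^ 2 = ‖comp 1 f‖ ^ 2 + a ^ 2 * ‖comp 2 f‖ ^ 2 - a * ‖comp 0 f‖ ^ 2 := by
  have h := re_inner_position_deriv f
  change ‖(a : ℂ) • comp 2 f + comp 1 f‖ ^ 2 = _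
  rw [norm_add_sq (𝕜 := ℂ), inner_smul_left, norm_smul, mul_pow]
  simp
  linear_combination a * h

theorem norm_creation_sq (a : ℝ) (f : formSpace) :
    ‖creation a f‖ ^ 2 = ‖comp 1 f‖ ^ 2 + a ^ 2 * ‖comp 2 f‖ ^ 2 + a * ‖comp 0 f‖ ^ 2 := by
  have h := re_inner_position_deriv f
  change ‖(a : ℂ) • comp 2 f - comp 1 f‖ ^ 2 = _
  rw [norm_sub_sq (𝕜 := ℂ), inner_smul_left, norm_smul, mul_pow]
  simp
  linear_combination -a * h

theorem inner_creation (a : ℝ) (v w : formSpace) :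
    inner ℂ (creation a v) (comp 0 w) = inner ℂ (comp 0 v) (annihilation a w) := by
  change inner ℂ ((a : ℂ) • comp 2 v - comp 1 v) _ = inner ℂ _ ((a : ℂ) • comp 2 w + comp 1 w)
  rw [inner_sub_left, inner_add_right, inner_smul_left, inner_smul_right, inner_position,
    inner_deriv, Complex.conj_ofReal]
  ring

theorem annihilation_gaussian {a : ℝ} (ha : 0 < (a : ℂ).re) : annihilation a (gaussian a ha) = 0 := by
  change (a : ℂ) • comp 2 (gaussian a ha) + comp 1 (gaussian a ha) = 0
  rw [comp_one_gaussian, neg_smul, add_neg_cancel]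

/-- All three terms of `‖(ax - d/dx)f‖²` are nonnegative, so the creation operator is bounded below
in the form norm. -/
theorem isClosed_range_creation {a : ℝ} (ha : 0 < a) :
    IsClosed (LinearMap.range (creation a : formSpace →ₗ[ℂ] L2R) : Set L2R) := by
  obtain ⟨k, hk, h1, h2, h3⟩ : ∃ k : ℝ, 0 < k ∧ k ^ 2 ≤ 1 ∧ k ^ 2 ≤ a ∧ k ^ 2 ≤ a ^ 2 := by
    refine ⟨min 1 a / (1 + a), by positivity, ?_, ?_, ?_⟩
    · refine pow_le_one₀ (by positivity) ?_
      rw [div_le_one (by positivity)]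
      linarith [min_le_left 1 a]
    · rw [div_pow, div_le_iff₀ (by positivity), sq]
      nlinarith [mul_le_mul (min_le_left 1 a) (min_le_right 1 a) (by positivity) zero_le_one,
        mul_pos ha ha, mul_pos ha (mul_pos ha ha)]
    · refine pow_le_pow_left₀ (by positivity) ?_ 2
      rw [div_le_iff₀ (by positivity)]
      nlinarith [min_le_right 1 a]
  have hb : ∀ f : formSpace, ‖f‖ ≤ k⁻¹ * ‖creation a f‖ := by
    intro f
    rw [← div_eq_inv_mul, le_div_iff₀ hk]
    refine le_of_sq_le_sq ?_ (norm_nonneg _)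
    rw [mul_pow, norm_creation_sq, norm_sq_eq]
    nlinarith [mul_le_mul_of_nonneg_right h1 (sq_nonneg ‖comp 1 f‖),
      mul_le_mul_of_nonneg_right h2 (sq_nonneg ‖comp 0 f‖),
      mul_le_mul_of_nonneg_right h3 (sq_nonneg ‖comp 2 f‖)]
  have hanti : AntilipschitzWith (Real.toNNReal k⁻¹) (creation a) :=
    (creation a).antilipschitz_of_bound fun f => by
      rw [Real.coe_toNNReal _ (by positivity)]
      exact hb f
  exact hanti.isClosed_range (creation a).uniformContinuous

/-- Every square integrable function orthogonal to the Gaussian lies in the range of the creation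
operator. -/
theorem exists_creation_eq {a : ℝ} (ha : 0 < (a : ℂ).re) (h : L2R)
    (hh : inner ℂ (comp 0 (gaussian a ha)) h = 0) : ∃ u, creation a u = h := by
  have hc := isClosed_range_creation (a := a) (by simpa using ha)
  have := hc.completeSpace_coe
  change h ∈ LinearMap.range (creation a : formSpace →ₗ[ℂ] L2R)
  rw [← Submodule.orthogonal_orthogonal (LinearMap.range (creation a : formSpace →ₗ[ℂ] L2R)),
    Submodule.mem_orthogonal]
  intro k hk
  -- The orthogonal complement of the range consists of multiples of the Gaussian; a closed range
  -- equals its double complement.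
  obtain ⟨κ, rfl⟩ := eq_smul_gaussian_of_inner_eq_zero ha k fun φ hφ hs =>
    (Submodule.mem_orthogonal _ _).1 hk _ ⟨ofTestFunction hφ hs, rfl⟩
  rw [inner_smul_left, hh, mul_zero]

/-- With `A = ax + d/dx` and `f = A*u`, one has `‖f‖² = ⟨u, Af⟩ ≤ ‖u‖‖Af‖`, while `‖f‖² = ‖Au‖² +
2a‖u‖² ≥ 2a‖u‖²`. -/
theorem norm_sq_le_norm_annihilation_sq {a : ℝ} (ha : 0 < (a : ℂ).re) (f : formSpace)
    (hf : inner ℂ (comp 0 (gaussian a ha)) (comp 0 f) = 0) :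
    2 * a * ‖comp 0 f‖ ^ 2 ≤ ‖annihilation a f‖ ^ 2 := by
  have ha' : 0 < a := by simpa using ha
  obtain ⟨u, hu⟩ := exists_creation_eq ha _ hf
  have h1 := norm_creation_sq a u
  have h2 := norm_annihilation_sq a u
  have h3 := sq_nonneg ‖annihilation a u‖
  rw [hu] at h1
  have h4 : ‖comp 0 f‖ ^ 2 ≤ ‖comp 0 u‖ * ‖annihilation a f‖ := by
    have h5 := norm_inner_le_norm (𝕜 := ℂ) (comp 0 u) (annihilation a f)
    rw [← inner_creation, hu, inner_self_eq_norm_sq_to_K] at h5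
    simpa using h5
  by_cases h0 : ‖comp 0 f‖ = 0
  · rw [h0]
    nlinarith [sq_nonneg ‖annihilation a f‖]
  · have h6 : 0 < ‖comp 0 f‖ ^ 2 := by positivity
    have h7 : (‖comp 0 f‖ ^ 2) ^ 2 ≤ (‖comp 0 u‖ * ‖annihilation a f‖) ^ 2 :=
      pow_le_pow_left₀ h6.le h4 2
    rw [mul_pow] at h7
    have h8 : 2 * a * ‖comp 0 u‖ ^ 2 ≤ ‖comp 0 f‖ ^ 2 := by linarith
    refine le_of_mul_le_mul_right ?_ h6
    have h9 := mul_le_mul_of_nonneg_right h8 (sq_nonneg ‖annihilation a f‖)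
    have h10 := mul_le_mul_of_nonneg_left h7 (show 0 ≤ 2 * a by positivity)
    linarith

/-- The gap estimate applies after removing the Gaussian component, which `annihilation a` kills. -/
theorem two_mul_norm_sq_sub_le {a : ℝ} (ha : 0 < (a : ℂ).re) (f : formSpace) :
    2 * a * ‖comp 0 f - (inner ℂ (comp 0 (gaussian a ha)) (comp 0 f) /
      (‖comp 0 (gaussian a ha)‖ : ℂ) ^ 2) • comp 0 (gaussian a ha)‖ ^ 2 ≤
      ‖annihilation a f‖ ^ 2 := by
  set κ := inner ℂ (comp 0 (gaussian a ha)) (comp 0 f) / (‖comp 0 (gaussian a ha)‖ : ℂ) ^ 2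
  have hg := comp_zero_gaussian_ne_zero _ ha
  have hg' : (‖comp 0 (gaussian a ha)‖ : ℂ) ≠ 0 := by simpa using hg
  have := norm_sq_le_norm_annihilation_sq ha (f - κ • gaussian a ha) (by
    have e : inner ℂ (comp 0 (gaussian a ha)) (comp 0 (gaussian a ha)) =
      (‖comp 0 (gaussian a ha)‖ : ℂ) ^ 2 := inner_self_eq_norm_sq_to_K _
    rw [map_sub, map_smul, inner_sub_right, inner_smul_right, e]
    simp only [κ]
    rw [div_mul_cancel₀ _ (pow_ne_zero 2 hg'), sub_self])
  rwa [map_sub, map_smul, map_sub, map_smul, annihilation_gaussian, smul_zero, sub_zero] at this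

theorem eq_smul_gaussian_of_annihilation_eq_zero {a : ℝ} (ha : 0 < (a : ℂ).re) {f : formSpace}
    (hf : annihilation a f = 0) : ∃ κ : ℂ, f = κ • gaussian a ha := by
  have ha' : 0 < a := by simpa using ha
  have h := two_mul_norm_sq_sub_le ha f
  rw [hf, norm_zero] at h
  refine ⟨inner ℂ (comp 0 (gaussian a ha)) (comp 0 f) / (‖comp 0 (gaussian a ha)‖ : ℂ) ^ 2,
    ext_comp_zero (Eq.trans ?_ (map_smul _ _ _).symm)⟩
  rw [← sub_eq_zero, ← norm_eq_zero, ← pow_eq_zero_iff two_ne_zero]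
  refine le_antisymm ?_ (sq_nonneg _)
  exact nonpos_of_mul_nonpos_right (h.trans_eq (by norm_num)) (by positivity : 0 < 2 * a)

/-- Adding the projection to the ground state makes the annihilation form coercive. -/
theorem exists_coercive {a : ℝ} (ha : 0 < (a : ℂ).re) : ∃ δ : ℝ, 0 < δ ∧ ∀ f : formSpace,
    δ * ‖f‖ ^ 2 ≤ ‖annihilation a f‖ ^ 2 +
      ‖inner ℂ (comp 0 (gaussian a ha)) (comp 0 f)‖ ^ 2 := by
  have ha' : 0 < a := by simpa using ha
  set N := ‖comp 0 (gaussian a ha)‖ with hN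
  have hN0 : 0 < N := norm_pos_iff.2 (comp_zero_gaussian_ne_zero _ ha)
  -- The two terms of `K` control the parts of `f` orthogonal and parallel to the Gaussian. The
  -- derivative and position terms then follow from `‖f'‖² + a²‖xf‖² = ‖Af‖² + a‖f‖²`, where `A = ax
  -- + d/dx`.
  set K : ℝ := 1 / a + 2 / N ^ 2 with hK
  have hK0 : 0 < K := by positivity
  refine ⟨(K + (1 + a * K) * (1 + 1 / a ^ 2))⁻¹, by positivity, fun f => ?_⟩
  set I := ‖inner ℂ (comp 0 (gaussian a ha)) (comp 0 f)‖ with hI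
  rw [inv_mul_le_iff₀ (by positivity), norm_sq_eq]
  have h := two_mul_norm_sq_sub_le ha f
  have hA := norm_annihilation_sq a f
  set A := ‖annihilation a f‖ ^ 2
  have hA0 : 0 ≤ A := sq_nonneg _
  have h0 : ‖comp 0 f‖ ^ 2 ≤ K * (A + I ^ 2) := by
    set p := (inner ℂ (comp 0 (gaussian a ha)) (comp 0 f) / (N : ℂ) ^ 2) • comp 0 (gaussian a ha)
      with hp
    have hpn : ‖p‖ ^ 2 = I ^ 2 / N ^ 2 := by
      rw [hp, norm_smul, norm_div, norm_pow, Complex.norm_real, ← hN, Real.norm_of_nonneg hN0.le,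
        ← hI]
      field_simp
    have h1 : ‖comp 0 f‖ ≤ ‖comp 0 f - p‖ + ‖p‖ := by
      simpa using norm_add_le (comp 0 f - p) p
    have h2 : ‖comp 0 f‖ ^ 2 ≤ 2 * ‖comp 0 f - p‖ ^ 2 + 2 * ‖p‖ ^ 2 := by
      nlinarith [norm_nonneg (comp 0 f), sq_nonneg (‖comp 0 f - p‖ - ‖p‖)]
    have h3 : 2 * ‖comp 0 f - p‖ ^ 2 ≤ 1 / a * A := by
      rw [one_div, ← div_eq_inv_mul, le_div_iff₀ ha']
      linarith
    have h4 : 2 * ‖p‖ ^ 2 = 2 / N ^ 2 * I ^ 2 := by rw [hpn]; ring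
    have h5 : 0 ≤ 2 / N ^ 2 * A := by positivity
    have h6 : 0 ≤ 1 / a * I ^ 2 := by positivity
    rw [hK]
    linarith
  have h1 : ‖comp 1 f‖ ^ 2 + a ^ 2 * ‖comp 2 f‖ ^ 2 ≤ (1 + a * K) * (A + I ^ 2) := by
    have := mul_le_mul_of_nonneg_left h0 ha'.le
    nlinarith [sq_nonneg I]
  have h2 : ‖comp 1 f‖ ^ 2 ≤ (1 + a * K) * (A + I ^ 2) := by
    nlinarith [mul_nonneg (sq_nonneg a) (sq_nonneg ‖comp 2 f‖)]
  have h3 : ‖comp 2 f‖ ^ 2 ≤ 1 / a ^ 2 * ((1 + a * K) * (A + I ^ 2)) := by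
    rw [one_div, ← div_eq_inv_mul, le_div_iff₀ (by positivity)]
    nlinarith [sq_nonneg ‖comp 1 f‖]
  linarith

end formSpace

/-! ### The spectrum -/

/-- A rank one perturbation of a bijective linear map is bijective as soon as it is injective. -/
theorem bijective_of_add_rankOne {E : Type*} [AddCommGroup E] [Module ℂ E] (F : E →ₗ[ℂ] E)
    (ℓ : E →ₗ[ℂ] ℂ) (e : E) (hT : Function.Bijective fun x => F x + ℓ x • e)
    (hF : ∀ x, F x = 0 → x = 0) : Function.Bijective F := by
  refine ⟨(injective_iff_map_eq_zero F).2 hF, fun y => ?_⟩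
  obtain ⟨u, hu⟩ := hT.2 y
  obtain ⟨w, hw⟩ := hT.2 e
  simp only at hu hw
  -- Here `F w = (1 - ℓ w) • e`; if the factor vanished, injectivity would force `w = 0`,
  -- contradicting `ℓ w = 1`.
  have h1 : 1 - ℓ w ≠ 0 := by
    intro h
    have h1 : ℓ w = 1 := (sub_eq_zero.1 h).symm
    rw [h1, one_smul, add_eq_right] at hw
    rw [hF w hw, map_zero] at h1
    exact zero_ne_one h1
  refine ⟨u + (ℓ u / (1 - ℓ w)) • w, ?_⟩
  have hu' : F u = y - ℓ u • e := eq_sub_of_add_eq hu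
  have hw' : F w = (1 - ℓ w) • e := by rw [sub_smul, one_smul]; exact eq_sub_of_add_eq hw
  rw [map_add, map_smul, hu', hw', smul_smul, div_mul_cancel₀ _ h1, sub_add_cancel]

namespace formSpace

open ContinuousLinearMap (adjoint)

/-- The bounded operator on the form space representing the form `Q_c - z`. -/
def formOp (c z : ℂ) : formSpace →L[ℂ] formSpace :=
  (adjoint (comp 1)).comp (comp 1) + c • (adjoint (comp 2)).comp (comp 2)
    - z • (adjoint (comp 0)).comp (comp 0)

theorem inner_smul_right_eq (v f : formSpace) (r : ℂ) : inner ℂ v (r • f) = r * inner ℂ v f :=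
  inner_smul_right (𝕜 := ℂ) (E := formSpace) v f r

theorem inner_formOp (c z : ℂ) (v f : formSpace) : inner ℂ v (formOp c z f) =
    inner ℂ (comp 1 v) (comp 1 f) + c * inner ℂ (comp 2 v) (comp 2 f)
      - z * inner ℂ (comp 0 v) (comp 0 f) := by
  simp only [formOp, sub_apply, add_apply, smul_apply, ContinuousLinearMap.comp_apply,
    inner_sub_right, inner_add_right]
  rw [inner_smul_right_eq, inner_smul_right_eq, ContinuousLinearMap.adjoint_inner_right,
    ContinuousLinearMap.adjoint_inner_right, ContinuousLinearMap.adjoint_inner_right]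

/-- This turns `(H_c - z) f = h` into an equation for a bounded operator on the form space. -/
theorem formOp_eq_iff (c z : ℂ) (f : formSpace) (h : L2R) :
    formOp c z f = adjoint (comp 0) h ↔ (comp 0 f, h + z • comp 0 f) ∈ (complexOscillator c).graph := by
  rw [mem_graph_iff]
  have key : ∀ w v : formSpace, inner ℂ v (formOp c z w) = inner ℂ v (adjoint (comp 0) h) ↔
      inner ℂ (comp 1 v) (comp 1 w) + c * inner ℂ (comp 2 v) (comp 2 w) =
        inner ℂ (comp 0 v) (h + z • comp 0 w) := fun w v => by
    rw [inner_formOp, ContinuousLinearMap.adjoint_inner_right, inner_add_right, inner_smul_right,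
      sub_eq_iff_eq_add]
  constructor
  · intro hf
    exact ⟨f, rfl, fun v => (key f v).1 (by rw [hf])⟩
  · rintro ⟨w, hw, h1⟩
    obtain rfl := ext_comp_zero hw
    exact ext_inner_left ℂ fun v => (key w v).2 (h1 v)

/-- The resolvent is `J T⁻¹ J*`, with `T = formOp c z` and `J = comp 0` the inclusion into `L²`;
`T⁻¹` is bounded by the open mapping theorem. -/
theorem mem_resolventPoints_of_bijective (c z : ℂ) (hb : Function.Bijective (formOp c z)) :
    z ∈ resolventPoints (complexOscillator c) := by
  let e : formSpace ≃L[ℂ] formSpace := ContinuousLinearEquiv.ofBijective (formOp c z)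
    (LinearMap.ker_eq_bot.2 hb.1) (LinearMap.range_eq_top.2 hb.2)
  have he : ∀ f, e f = formOp c z f := fun _ => rfl
  refine ⟨(comp 0).comp ((e.symm : formSpace →L[ℂ] formSpace).comp (adjoint (comp 0))),
    fun y => ?_, fun x => ?_⟩
  · have h1 : formOp c z (e.symm (adjoint (comp 0) y)) = adjoint (comp 0) y := by
      rw [← he, e.apply_symm_apply]
    rw [formOp_eq_iff] at h1
    obtain ⟨u, hu1, hu2⟩ := (LinearPMap.mem_graph_iff _).1 h1
    refine ⟨LinearPMap.mem_domain_of_mem_graph h1, ?_⟩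
    rw [sub_eq_iff_eq_add]
    refine Eq.trans ?_ hu2
    exact congrArg (complexOscillator c) (Subtype.ext hu1.symm)
  · have hg := LinearPMap.mem_graph (complexOscillator c) x
    obtain ⟨f, hf, -⟩ := (mem_graph_iff c _).1 hg
    change comp 0 f = (x : L2R) at hf
    have h1 : formOp c z f = adjoint (comp 0) (complexOscillator c x - z • (x : L2R)) := by
      rw [formOp_eq_iff, hf, sub_add_cancel]
      exact hg
    rw [ContinuousLinearMap.comp_apply, ContinuousLinearMap.comp_apply, ← h1, ← he]
    exact (congrArg (comp 0) (e.symm_apply_apply f)).trans hf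

theorem inner_gaussian_gaussian_ne_zero {a b : ℝ} (ha : 0 < (a : ℂ).re) (hb : 0 < (b : ℂ).re) :
    inner ℂ (comp 0 (gaussian a ha)) (comp 0 (gaussian b hb)) ≠ 0 := by
  have hr : 0 < (((a + b) / 2 : ℝ) : ℂ).re := by
    simp only [Complex.ofReal_re] at ha hb ⊢
    positivity
  have h1 : inner ℂ (comp 0 (gaussian a ha)) (comp 0 (gaussian b hb)) =
      ∫ x : ℝ, Complex.exp (-(((a + b) / 2 : ℝ) : ℂ) * (x : ℂ) ^ 2) := by
    rw [← integral_mul_conj_eq_inner]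
    refine integral_congr_ae ?_
    filter_upwards [gaussian_ae a ha, gaussian_ae b hb] with x h1 h2
    rw [h1, h2, ← Complex.exp_conj, ← Complex.exp_add]
    congr 1
    simp [Complex.conj_ofReal, Complex.conj_ofNat]
    ring
  intro h
  have h2 := integral_gaussian_sq_complex hr
  rw [← h1, h, zero_pow two_ne_zero] at h2
  refine div_ne_zero (Complex.ofReal_ne_zero.2 Real.pi_ne_zero) (fun h3 => ?_) h2.symm
  rw [h3] at hr
  simp at hr

/-- No real Gaussian is an eigenfunction of `H_c` for non-real `c`. -/
theorem formOp_gaussian_ne_zero {c : ℂ} (hc : c.im ≠ 0) (z : ℂ) {a : ℝ} (ha : 0 < (a : ℂ).re) :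
    formOp c z (gaussian a ha) ≠ 0 := by
  intro h
  -- Test against `e^{-bx²/2}`, using `⟨g_b, g_a⟩ = (a + b)⟨xg_b, xg_a⟩`. An affine function of `b`
  -- with two zeros vanishes, so `z = a` and `c = a²` would be real.
  have key : ∀ b : ℝ, 0 < b → (a + b : ℂ) * (a - z) + (c - a ^ 2) = 0 := by
    intro b hb
    have hb' : 0 < (b : ℂ).re := by simpa using hb
    have h1 := inner_formOp c z (gaussian b hb') (gaussian a ha)
    rw [h, inner_zero_right, inner_deriv_gaussian_add] at h1
    have h2 := inner_position_deriv (gaussian b hb') (gaussian a ha)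
    rw [comp_one_gaussian, comp_one_gaussian, inner_smul_left, inner_smul_right, map_neg,
      Complex.conj_ofReal] at h2
    have h3 := inner_gaussian_gaussian_ne_zero hb' ha
    have h4 : inner ℂ (comp 2 (gaussian b hb')) (comp 2 (gaussian a ha)) ≠ 0 := fun h4 => by
      rw [h4] at h2
      exact h3 (by linear_combination h2)
    refine (mul_eq_zero.1 (?_ : inner ℂ (comp 2 (gaussian b hb')) (comp 2 (gaussian a ha)) *
      ((a + b : ℂ) * (a - z) + (c - a ^ 2)) = 0)).resolve_left h4
    linear_combination -h1 - (a - z) * h2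
  have h1 := key 1 one_pos
  have h2 := key 2 two_pos
  push_cast at h1 h2
  have h3 : (a : ℂ) - z = 0 := by linear_combination h2 - h1
  have h4 : c = ((a ^ 2 : ℝ) : ℂ) := by
    rw [h3] at h1
    push_cast
    linear_combination h1
  rw [h4, Complex.ofReal_im] at hc
  exact hc rfl

/-- Equality in `hρz` is allowed: coercivity can then fail only along the Gaussian, which is handled
by the rank one perturbation. -/
theorem bijective_formOp {c z ρ : ℂ} (hc : c.im ≠ 0) {a : ℝ} (ha : 0 < a) (hρ : ρ.re = 1)
    (hρc : (ρ * c).re = a ^ 2) (hρz : (ρ * z).re ≤ a) : Function.Bijective (formOp c z) := by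
  have ha' : 0 < (a : ℂ).re := by simpa using ha
  have hρ0 : ρ ≠ 0 := by
    rintro rfl
    simp at hρ
  have hre : ∀ f : formSpace, ‖annihilation a f‖ ^ 2 ≤ (inner ℂ f (ρ • formOp c z f)).re := by
    intro f
    have e : inner ℂ f (ρ • formOp c z f) = ρ * ((‖comp 1 f‖ ^ 2 : ℝ) : ℂ) +
        ρ * c * ((‖comp 2 f‖ ^ 2 : ℝ) : ℂ) - ρ * z * ((‖comp 0 f‖ ^ 2 : ℝ) : ℂ) := by
      rw [inner_smul_right_eq, inner_formOp, inner_self_eq_norm_sq_to_K, inner_self_eq_norm_sq_to_K,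
        inner_self_eq_norm_sq_to_K]
      simp
      ring
    rw [e, Complex.sub_re, Complex.add_re, Complex.re_mul_ofReal, Complex.re_mul_ofReal,
      Complex.re_mul_ofReal, hρ, hρc, norm_annihilation_sq]
    nlinarith [mul_le_mul_of_nonneg_right hρz (sq_nonneg ‖comp 0 f‖)]
  have hinj : ∀ f, (ρ • formOp c z) f = 0 → f = 0 := by
    intro f hf
    have h1 := hre f
    rw [show ρ • formOp c z f = 0 from hf, inner_zero_right, Complex.zero_re] at h1
    have h2 : annihilation a f = 0 := by
      rw [← norm_eq_zero, ← pow_eq_zero_iff two_ne_zero]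
      exact le_antisymm h1 (sq_nonneg _)
    obtain ⟨κ, rfl⟩ := eq_smul_gaussian_of_annihilation_eq_zero ha' h2
    have h3 : formOp c z (κ • gaussian a ha') = 0 := (smul_eq_zero.1 hf).resolve_left hρ0
    rw [map_smul] at h3
    rw [(smul_eq_zero.1 h3).resolve_right (formOp_gaussian_ne_zero hc z ha'), zero_smul]
  obtain ⟨δ, hδ, hco⟩ := exists_coercive ha'
  let g : formSpace := adjoint (comp 0) (comp 0 (gaussian a ha'))
  let ℓ : formSpace →L[ℂ] ℂ := innerSL ℂ g
  have hℓ : ∀ f, ℓ f = inner ℂ (comp 0 (gaussian a ha')) (comp 0 f) := fun f =>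
    ContinuousLinearMap.adjoint_inner_left (comp 0) f (comp 0 (gaussian a ha'))
  have hunit : IsUnit (ρ • formOp c z + ℓ.smulRight g) := by
    refine ContinuousLinearMap.isUnit_of_forall_le_norm_inner_map _ (c := ⟨δ, hδ.le⟩) hδ
      fun f => ?_
    have e : inner ℂ f ((ρ • formOp c z + ℓ.smulRight g) f) =
        inner ℂ f (ρ • formOp c z f) + ((‖ℓ f‖ ^ 2 : ℝ) : ℂ) := by
      rw [add_apply, inner_add_right, ContinuousLinearMap.smulRight_apply, inner_smul_right,
        ← inner_conj_symm f g, show inner ℂ g f = ℓ f from rfl, Complex.mul_conj,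
        Complex.normSq_eq_norm_sq]
      rfl
    rw [norm_inner_symm, mul_comm]
    refine le_trans ?_ (Complex.re_le_norm _)
    rw [e, Complex.add_re, Complex.ofReal_re, hℓ]
    exact (hco f).trans (by linarith [hre f])
  have hbij := bijective_of_add_rankOne ((ρ • formOp c z : formSpace →L[ℂ] formSpace) :
    formSpace →ₗ[ℂ] formSpace) (ℓ : formSpace →ₗ[ℂ] ℂ) g
    (ContinuousLinearMap.isUnit_iff_bijective.1 hunit) hinj
  have h2 : Function.Bijective fun f : formSpace => ρ⁻¹ • f :=
    MulAction.bijective₀ (inv_ne_zero hρ0)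
  have h3 := h2.comp hbij
  convert h3 using 1
  ext1 f
  exact (inv_smul_smul₀ hρ0 (formOp c z f)).symm

end formSpace

/-- The lines `s + a²t = a` are the tangents to `st = 1/4` at `(a/2, 1/(2a))`, and their half-planes
cut out the convex region. -/
theorem exists_pos_add_sq_mul_le {s t : ℝ} (h : ¬(0 < s ∧ 0 < t ∧ 1 / 4 < s * t)) :
    ∃ a : ℝ, 0 < a ∧ s + a ^ 2 * t ≤ a := by
  by_cases hs : 0 < s
  · by_cases ht : 0 < t
    · have h1 : s * t ≤ 1 / 4 := not_lt.1 fun h1 => h ⟨hs, ht, h1⟩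
      exact ⟨2 * s, by positivity, by nlinarith⟩
    · exact ⟨s, hs, by nlinarith [sq_nonneg s]⟩
  · by_cases ht : 0 < t
    · refine ⟨1 / t, by positivity, ?_⟩
      have : (1 / t) ^ 2 * t = 1 / t := by field_simp
      linarith
    · exact ⟨1, one_pos, by linarith⟩

theorem spec_complexOscillator_subset {c : ℂ} (hc : c.im ≠ 0) :
    spec (complexOscillator c) ⊆ interior (numRange (complexOscillator c)) := by
  intro z hz
  by_contra hzi
  let t : ℂ → ℝ := fun w => w.im / c.im
  let s : ℂ → ℝ := fun w => w.re - c.re * t w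
  have ht : Continuous t := Complex.continuous_im.div_const _
  have hs : Continuous s := Complex.continuous_re.sub (continuous_const.mul ht)
  have hst : ∀ w, w = s w + c * t w := fun w => by
    apply Complex.ext
    · simp [s]
    · simp [s, t]
      field_simp
  have hU : IsOpen {w | 0 < s w ∧ 0 < t w ∧ 1 / 4 < s w * t w} :=
    (isOpen_lt continuous_const hs).inter ((isOpen_lt continuous_const ht).inter
      (isOpen_lt continuous_const (hs.mul ht)))
  have hsub : {w | 0 < s w ∧ 0 < t w ∧ 1 / 4 < s w * t w} ⊆ numRange (complexOscillator c) := by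
    rintro w ⟨h1, h2, h3⟩
    rw [formSpace.numRange_complexOscillator]
    exact ⟨s w, t w, h1.le, h2.le, h3.le, hst w⟩
  obtain ⟨a, ha, hle⟩ := exists_pos_add_sq_mul_le (s := s z) (t := t z) fun h =>
    hzi (interior_maximal hsub hU h)
  -- The real functional `w ↦ Re (ρw)` takes the value `1` at `1` and `a²` at `c`, so it sends `z`
  -- to `s z + a² t z`.
  let ρ : ℂ := ⟨1, (c.re - a ^ 2) / c.im⟩
  have hρc : (ρ * c).re = a ^ 2 := by
    rw [Complex.mul_re]
    simp only [ρ]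
    field_simp
    ring
  refine hz (formSpace.mem_resolventPoints_of_bijective c z
    (formSpace.bijective_formOp (ρ := ρ) hc ha rfl hρc ?_))
  rw [hst z, mul_add, ← mul_assoc, Complex.add_re, Complex.re_mul_ofReal, Complex.re_mul_ofReal,
    hρc]
  simpa [ρ] using hle

theorem propositiont20 (c : ℂ) (hc : 0 < c.re) :
    numRange (complexOscillator c) =
      {z : ℂ | ∃ t₁ t₂ : ℝ, 0 ≤ t₁ ∧ 0 ≤ t₂ ∧ 1 / 4 ≤ t₁ * t₂ ∧ z = t₁ + c * t₂} ∧
    (c.im ≠ 0 →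
      spec (complexOscillator c) ⊆ interior (numRange (complexOscillator c))) :=
  ⟨formSpace.numRange_complexOscillator c, spec_complexOscillator_subset⟩

end
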